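/- Let $F$ be a field of characteristic zero, $G$ a group with unit $e$, and let $(g_1,\dots,g_n)\in G^n$ have pairwise distinct entries. Grade $M_n(F)$ by letting $e_{ij}$ have degree $g_i^{-1}g_j$, and let $B$ be a subalgebra of $M_n(F)$ generated by matrix units $e_{ij}$, with the induced grading $B=\bigoplus_{g\in G}B_g$ and support $G_0=\{g\in G: B_g\neq 0\}$. Let $E=E_0\oplus E_1$ be the Grassmann algebra of an infinite-dimensional $F$-vector space, graded by parity of length, and give $B\otimes E$ the $G\times\mathbb Z_2$-grading $(B\otimes E)_{(g,\delta)}=B_g\otimes E_\delta$. Let $F\langle Z\rangle$ be the free associative (non-unital) algebra on variables $x_g^{(i)}$ of degree $(g,0)$ and $y_g^{(i)}$ of degree $(g,1)$ ($g\in G$, $i\in\mathbb N$), and let each $z_g^{(i)}$ stand for either $x_g^{(i)}$ or $y_g^{(i)}$. A set of polynomials is a basis of the graded identities of $B\otimes E$ if the two-sided ideal of graded identities of $B\otimes E$ is the smallest two-sided ideal of $F\langle Z\rangle$ that contains the set and is invariant under all graded endomorphisms of $F\langle Z\rangle$. Then a basis of the $G\times\mathbb Z_2$-graded polynomial identities of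 $B\otimes E$ consists of the polynomials $$x_e^{(1)}z_e^{(2)}-z_e^{(2)}x_e^{(1)},\qquad y_e^{(1)}y_e^{(2)}+y_e^{(2)}y_e^{(1)}\qquad(\text{if } e\in G_0),$$ and, for each $g\in G_0$ with $g\neq e$, $$z_g^{(1)}x_{g^{-1}}^{(2)}x_g^{(3)}-x_g^{(3)}x_{g^{-1}}^{(2)}z_g^{(1)},\qquad x_g^{(1)}y_{g^{-1}}^{(2)}x_g^{(3)}-x_g^{(3)}y_{g^{-1}}^{(2)}x_g^{(1)},$$ $$y_g^{(1)}y_{g^{-1}}^{(2)}x_g^{(3)}+x_g^{(3)}y_{g^{-1}}^{(2)}y_g^{(1)},\qquad y_g^{(1)}x_{g^{-1}}^{(2)}y_g^{(3)}+y_g^{(3)}x_{g^{-1}}^{(2)}y_g^{(1)},\qquad y_g^{(1)}y_{g^{-1}}^{(2)}y_g^{(3)}+y_g^{(3)}y_{g^{-1}}^{(2)}y_g^{(1)},$$ together with the variables $z_g^{(1)}$ for each $g\in G$ with $B_g=0$, and the monomials $z_{g_1}^{(1)}\cdots z_{g_p}^{(p)}$, where $2\le p\le 2n-1$ and $g_1,\dots,g_p\in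 G_0$ are (arbitrary, possibly repeated) elements such that $x_{g_1}^{(1)}\cdots x_{g_p}^{(p)}$ is a $G$-graded identity of $B$; there are only finitely many of these last monomials. -/

import Mathlib

open scoped TensorProduct

noncomputable section

namespace GradedPI

/-! ### Free graded algebra and graded polynomial identities -/

/-- The free associative (non-unital) algebra `F⟨X | H⟩` on the variables `x_h^{(i)}`,
`(h, i) ∈ H × ℕ`; it has the nonempty words in these variables as a basis. -/
abbrev FreeGraded (F H : Type*) [Field F] : Type _ :=
  MonoidAlgebra F (FreeSemigroup (H × ℕ))

section Identities

variable (F : Type*) [Field F] {H : Type*}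

/-- The monomial given by a nonempty word. -/
def word (w : FreeSemigroup (H × ℕ)) : FreeGraded F H := MonoidAlgebra.single w 1

/-- The variable `x_h^{(i)}`. -/
def gvar (h : H) (i : ℕ) : FreeGraded F H := word F (FreeSemigroup.of (h, i))

/-- The multilinear monomial `x_{d_1}^{(1)} x_{d_2}^{(2)} ⋯ x_{d_{q+1}}^{(q+1)}` of degree `q + 1`,
where `d_{k+1}` is `d k`. -/
def multilinearMonomial {q : ℕ} (d : Fin (q + 1) → H) : FreeGraded F H :=
  word F ⟨(d 0, 1), List.ofFn fun k : Fin q => (d k.succ, (k : ℕ) + 2)⟩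

/-- The homogeneous component of degree `h` of `F⟨X | H⟩`: the span of the words whose
variables have degrees with product `h`. -/
def freeComponent [Group H] (h : H) : Submodule F (FreeGraded F H) :=
  Submodule.span F {f | ∃ w : FreeSemigroup (H × ℕ),
    FreeSemigroup.lift (Prod.fst : H × ℕ → H) w = h ∧ f = word F w}

variable {F}

/-- A `T_H`-ideal: a two-sided ideal of the algebra `F⟨X | H⟩` which is invariant under all
graded endomorphisms. -/
structure IsTIdeal [Group H] (I : Submodule F (FreeGraded F H)) : Prop where
  mul_left_mem : ∀ a f, f ∈ I → a * f ∈ I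
  mul_right_mem : ∀ a f, f ∈ I → f * a ∈ I
  map_mem : ∀ φ : FreeGraded F H →ₙₐ[F] FreeGraded F H,
    (∀ h, ∀ f ∈ freeComponent F h, φ f ∈ freeComponent F h) → ∀ f ∈ I, φ f ∈ I

/-- The `T_H`-ideal generated by `S`: the intersection of all `T_H`-ideals containing `S`. -/
def tIdealSpan [Group H] (S : Set (FreeGraded F H)) : Submodule F (FreeGraded F H) :=
  sInf {I | IsTIdeal I ∧ S ⊆ I}

variable {A : Type*} [NonUnitalRing A] [Module F A] [SMulCommClass F A A] [IsScalarTower F A A]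

/-- Substitution of elements of an associative algebra for the variables. -/
def evalAt (a : H × ℕ → A) : FreeGraded F H →ₙₐ[F] A :=
  MonoidAlgebra.liftMagma F (FreeSemigroup.lift a)

/-- `T_H(A)`: the graded polynomial identities of an algebra `A` with homogeneous
components `𝒜 h`. -/
def gradedIdentities (𝒜 : H → Submodule F A) : Submodule F (FreeGraded F H) where
  carrier := {f | ∀ a : H × ℕ → A, (∀ v, a v ∈ 𝒜 v.1) → evalAt a f = 0}
  add_mem' hf hg a ha := by rw [map_add, hf a ha, hg a ha, add_zero]
  zero_mem' a _ := map_zero _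
  smul_mem' c f hf a ha := by rw [map_smul, hf a ha, smul_zero]

/-- `S` is a basis of the graded polynomial identities of `A`. -/
def IsIdentityBasis [Group H] (S : Set (FreeGraded F H)) (𝒜 : H → Submodule F A) : Prop :=
  tIdealSpan S = gradedIdentities 𝒜

end Identities

/-! ### Algebras generated by matrix units, with elementary gradings -/

section Matrices

variable (F : Type*) [Field F] {G : Type*} [Group G] {n : ℕ}

/-- The (not necessarily unital) subalgebra of `M_n(F)` generated by the matrix units `e_ij`,
`(i, j) ∈ S`. -/
def matrixUnitAlgebra (S : Set (Fin n × Fin n)) :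
    NonUnitalSubalgebra F (Matrix (Fin n) (Fin n) F) :=
  NonUnitalAlgebra.adjoin F {M | ∃ p ∈ S, M = Matrix.single p.1 p.2 1}

/-- The component of degree `h` of the elementary grading of `M_n(F)` induced by the tuple `g`:
the span of the `e_ij` with `g_i⁻¹ g_j = h`. -/
def elementaryComponent (g : Fin n → G) (h : G) : Submodule F (Matrix (Fin n) (Fin n) F) :=
  Submodule.span F {M | ∃ i j, (g i)⁻¹ * g j = h ∧ M = Matrix.single i j 1}

variable {F}

/-- The component `B_h = B ∩ M_n(F)_h` of a subalgebra `B` of `M_n(F)`, as a subspace of `B`. -/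
def inducedComponent (B : NonUnitalSubalgebra F (Matrix (Fin n) (Fin n) F)) (g : Fin n → G)
    (h : G) : Submodule F B :=
  (elementaryComponent F g h).comap B.toSubmodule.subtype

/-- The support `G₀` of the induced grading on `B`. -/
def gradingSupport (B : NonUnitalSubalgebra F (Matrix (Fin n) (Fin n) F)) (g : Fin n → G) :
    Set G :=
  {h | inducedComponent B g h ≠ ⊥}

end Matrices

/-! ### Tensor product with the Grassmann algebra -/

/-- The group `G × ℤ/2`, with the second factor written multiplicatively. -/
abbrev SuperDeg (G : Type*) : Type _ := G × Multiplicative (ZMod 2)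

/-- The component of parity `δ` of the Grassmann algebra of `V`: the sum of the exterior
powers of `V` of exponents congruent to `δ` modulo `2`. -/
def grassmannComponent (F V : Type*) [Field F] [AddCommGroup V] [Module F V] (δ : ZMod 2) :
    Submodule F (ExteriorAlgebra F V) :=
  ⨆ k : {k : ℕ // (k : ZMod 2) = δ}, ⋀[F]^(k : ℕ) V

/-- The `G × ℤ/2`-grading of `A ⊗ E`: the component of degree `(h, δ)` is `A_h ⊗ E_δ`. -/
def tensorComponent {F G A E : Type*} [Field F] [AddCommGroup A] [Module F A]
    [AddCommGroup E] [Module F E] (𝒜 : G → Submodule F A) (ℰ : ZMod 2 → Submodule F E)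
    (d : SuperDeg G) : Submodule F (A ⊗[F] E) :=
  Submodule.map₂ (TensorProduct.mk F A E) (𝒜 d.1) (ℰ d.2.toAdd)

/-! ### The superized polynomials -/

section Superized

variable (F : Type*) [Field F] {G : Type*}

/-- The variable of degree `(h, δ)` and index `i`: `x_h^{(i)}` if `δ = 0`,
`y_h^{(i)}` if `δ = 1`. -/
def zvar (δ : ZMod 2) (h : G) (i : ℕ) : FreeGraded F (SuperDeg G) :=
  gvar F (h, Multiplicative.ofAdd δ) i

/-- The even variable `x_h^{(i)}`. -/
def xvar (h : G) (i : ℕ) : FreeGraded F (SuperDeg G) := zvar F 0 h i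

/-- The odd variable `y_h^{(i)}`. -/
def yvar (h : G) (i : ℕ) : FreeGraded F (SuperDeg G) := zvar F 1 h i

/-- The superized polynomials attached to an algebra with support `G₀`, together with the
variables `z_h^{(1)}` with `h ∉ G₀`. -/
inductive SuperizedPolynomial [Group G] (G₀ : Set G) : FreeGraded F (SuperDeg G) → Prop
  | comm_xz (he : (1 : G) ∈ G₀) (δ : ZMod 2) :
      SuperizedPolynomial G₀ (xvar F 1 1 * zvar F δ 1 2 - zvar F δ 1 2 * xvar F 1 1)
  | comm_yy (he : (1 : G) ∈ G₀) :
      SuperizedPolynomial G₀ (yvar F 1 1 * yvar F 1 2 + yvar F 1 2 * yvar F 1 1)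
  | zxx (h : G) (hne : h ≠ 1) (hh : h ∈ G₀) (δ : ZMod 2) :
      SuperizedPolynomial G₀
        (zvar F δ h 1 * xvar F h⁻¹ 2 * xvar F h 3 - xvar F h 3 * xvar F h⁻¹ 2 * zvar F δ h 1)
  | xyx (h : G) (hne : h ≠ 1) (hh : h ∈ G₀) :
      SuperizedPolynomial G₀
        (xvar F h 1 * yvar F h⁻¹ 2 * xvar F h 3 - xvar F h 3 * yvar F h⁻¹ 2 * xvar F h 1)
  | yyx (h : G) (hne : h ≠ 1) (hh : h ∈ G₀) :
      SuperizedPolynomial G₀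
        (yvar F h 1 * yvar F h⁻¹ 2 * xvar F h 3 + xvar F h 3 * yvar F h⁻¹ 2 * yvar F h 1)
  | yxy (h : G) (hne : h ≠ 1) (hh : h ∈ G₀) :
      SuperizedPolynomial G₀
        (yvar F h 1 * xvar F h⁻¹ 2 * yvar F h 3 + yvar F h 3 * xvar F h⁻¹ 2 * yvar F h 1)
  | yyy (h : G) (hne : h ≠ 1) (hh : h ∈ G₀) :
      SuperizedPolynomial G₀
        (yvar F h 1 * yvar F h⁻¹ 2 * yvar F h 3 + yvar F h 3 * yvar F h⁻¹ 2 * yvar F h 1)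
  | single (h : G) (hh : h ∉ G₀) (δ : ZMod 2) : SuperizedPolynomial G₀ (zvar F δ h 1)

variable {F}

/-- The monomials `z_{h_1}^{(1)} ⋯ z_{h_p}^{(p)}` (each `z` being `x` or `y`), `2 ≤ p ≤ 2n - 1`,
with all `h_k` in the support of `B`, such that `x_{h_1}^{(1)} ⋯ x_{h_p}^{(p)}` is a graded
identity of `B`. Here `p = q + 1`. -/
def superMonomials [Group G] {n : ℕ} (B : NonUnitalSubalgebra F (Matrix (Fin n) (Fin n) F))
    (g : Fin n → G) : Set (FreeGraded F (SuperDeg G)) :=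
  {f | ∃ (q : ℕ) (h : Fin (q + 1) → G) (δ : Fin (q + 1) → ZMod 2),
    2 ≤ q + 1 ∧ q + 1 ≤ 2 * n - 1 ∧ (∀ k, h k ∈ gradingSupport B g) ∧
    multilinearMonomial F h ∈ gradedIdentities (inducedComponent B g) ∧
    f = multilinearMonomial F fun k => ((h k, Multiplicative.ofAdd (δ k)) : SuperDeg G)}

end Superized

end GradedPI

end

/-! Words become walks. A homogeneous matrix of degree `h` can have a nonzero entry in row `i` only
in the column `j` with `g j = g i * h`, and there is at most one such `j`. So the entry of an
evaluated word in row `i` is the product of weights along the walk in the group `G` that starts at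
`g i` and reads the word. For `B ⊗ E` the weights are elements of the Grassmann algebra, indexed by
labelled edges (vertex, variable). They have the parity of the variable and are supported on the
edges `(g i, g j)` with `e_ij ∈ B`; otherwise they are arbitrary (`mem_gradedIdentities_iff`).

Soundness: if `u` and `v` have equal degree and `t` has the inverse degree, then `u t v` and `v t u`
traverse the same edges. Their weights differ by the Koszul sign of reversing three homogeneous
factors, which is the sign in the listed polynomials. A monomial that reads no walk in `B` vanishes.

Completeness: scaling all edges by independent scalars separates an identity into sums over words
with one common multiset of labelled edges. Three facts settle each such sum modulo a `T`-ideal `I`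
that contains the list. (1) Words with equal edges are linked by interchanges `u t v → v t u`
(`walkEdges_perm_induction`), so they agree modulo `I` up to a sign, and the same sign relates their
weights. (2) Words that read no walk in `B` lie in `I`: a segment splits into at most `2 n - 1`
blocks whose degrees already read no walk (`exists_coarsening`), so it comes from a listed monomial
or variable. (3) Give the even edges of `B` weight `1` and the odd ones independent vectors. The
weight of a walk in `B` then vanishes only if an odd labelled edge is repeated; interchanging its
two occurrences shows that twice the word lies in `I`. If the weight does not vanish, the signed sum
of the coefficients is zero, so the sum of words lies in `I`. -/

noncomputable section

namespace GradedPI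

/-! ### Walks in a group -/

section Walks

variable {X G : Type*} [Group G] (δ : X → G)

/-- The product of the degrees of the letters of a list. -/
def listDeg (l : List X) : G := (l.map δ).prod

@[simp] theorem listDeg_nil : listDeg δ [] = 1 := rfl

@[simp] theorem listDeg_cons (x : X) (l : List X) : listDeg δ (x :: l) = δ x * listDeg δ l := by
  simp [listDeg]

@[simp] theorem listDeg_append (l m : List X) :
    listDeg δ (l ++ m) = listDeg δ l * listDeg δ m := by
  simp [listDeg]

/-- The labelled edges of the walk in `G` which starts at `s` and reads the list `l`:
reading the letter `x` at the vertex `s` leads to the vertex `s * δ x`. -/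
def walkEdges : G → List X → List (G × X)
  | _, [] => []
  | s, x :: l => (s, x) :: walkEdges (s * δ x) l

@[simp] theorem walkEdges_nil (s : G) : walkEdges δ s [] = [] := rfl

@[simp] theorem walkEdges_cons (s : G) (x : X) (l : List X) :
    walkEdges δ s (x :: l) = (s, x) :: walkEdges δ (s * δ x) l := rfl

theorem walkEdges_append (s : G) (l m : List X) :
    walkEdges δ s (l ++ m) = walkEdges δ s l ++ walkEdges δ (s * listDeg δ l) m := by
  induction l generalizing s with
  | nil => simp
  | cons x l ih => simp [ih, mul_assoc]

theorem walkEdges_mul (t s : G) (l : List X) :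
    walkEdges δ (t * s) l = (walkEdges δ s l).map (Prod.map (t * ·) id) := by
  induction l generalizing s with
  | nil => simp
  | cons x l ih => simp [← ih, mul_assoc]

theorem walkEdges_perm_mul_iff (t s : G) (l m : List X) :
    (walkEdges δ (t * s) l).Perm (walkEdges δ (t * s) m) ↔
      (walkEdges δ s l).Perm (walkEdges δ s m) := by
  rw [walkEdges_mul, walkEdges_mul]
  exact List.map_perm_map_iff ((mul_right_injective t).prodMap Function.injective_id)

/-- Left translation of `G` carries walks to walks, so the edges of two words may be compared from
any common start; below, the vertex `1` serves for all `g i` at once. -/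
theorem walkEdges_perm_iff (s t : G) (l m : List X) :
    (walkEdges δ s l).Perm (walkEdges δ s m) ↔ (walkEdges δ t l).Perm (walkEdges δ t m) := by
  rw [← walkEdges_perm_mul_iff δ (t * s⁻¹) s, inv_mul_cancel_right]

theorem mem_walkEdges {s r : G} {x : X} {l : List X} :
    (r, x) ∈ walkEdges δ s l ↔ ∃ p q, l = p ++ x :: q ∧ s * listDeg δ p = r := by
  constructor
  · intro h
    induction l generalizing s with
    | nil => simp at h
    | cons y l ih =>
      rcases List.mem_cons.1 h with h | h
      · obtain ⟨rfl, rfl⟩ := Prod.mk.inj h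
        exact ⟨[], l, by simp⟩
      · obtain ⟨p, q, rfl, rfl⟩ := ih h
        exact ⟨y :: p, q, by simp [mul_assoc]⟩
  · rintro ⟨p, q, rfl, rfl⟩
    simp [walkEdges_append]

/-- Since `u t` and `v t` close up, both orders read `u` and `v` from `s` and read `t` from the same
vertex; only the order of the edges changes. -/
theorem walkEdges_swap (s : G) {u t v : List X} (q : List X) (huv : listDeg δ u = listDeg δ v)
    (hut : listDeg δ u * listDeg δ t = 1) :
    (walkEdges δ s (u ++ t ++ v ++ q)).Perm (walkEdges δ s (v ++ t ++ u ++ q)) := by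
  have hvt : listDeg δ v * listDeg δ t = 1 := huv ▸ hut
  simp only [walkEdges_append, listDeg_append, huv, hvt, mul_one, one_mul]
  refine List.Perm.append_right _ ?_
  refine (List.perm_append_comm_assoc _ _ _ |>.trans ?_ |> (List.append_assoc _ _ _ ▸ ·))
  rw [List.append_assoc]
  refine (List.perm_append_comm.append_left _).trans ?_
  exact List.perm_append_comm_assoc _ _ _

theorem walkEdges_fst_mem {Q : Set G} {s : G} {l : List X} (hs : s ∈ Q)
    (h : ∀ e ∈ walkEdges δ s l, e.1 ∈ Q → e.1 * δ e.2 ∈ Q) : ∀ e ∈ walkEdges δ s l, e.1 ∈ Q := by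
  induction l generalizing s with
  | nil => simp
  | cons x l ih =>
    simp only [walkEdges_cons, List.forall_mem_cons] at h ⊢
    exact ⟨hs, ih (h.1 hs) h.2⟩

/-- Two closed-up pieces of a walk meet if another walk uses the same edges in one sweep. -/
theorem exists_common_vertex {s : G} {p q m : List X} (hp : p ≠ [])
    (h : (walkEdges δ s m).Perm (walkEdges δ 1 p ++ walkEdges δ s q)) :
    ∃ p₁ p₂ q₁ q₂, p = p₁ ++ p₂ ∧ q = q₁ ++ q₂ ∧ listDeg δ p₁ = s * listDeg δ q₁ := by
  by_contra! hcon
  obtain ⟨y, p', rfl⟩ := List.exists_cons_of_ne_nil hp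
  -- `Q` is the set of vertices of the walk `q`. If `p` avoids `Q`, an edge of `m` that starts in
  -- `Q` must come from `q` and so ends in `Q`. Hence `m` never leaves `Q`, although it has to use
  -- the first edge of `p`.
  let Q : Set G := {r | ∃ q₁ q₂, q = q₁ ++ q₂ ∧ s * listDeg δ q₁ = r}
  have key : ∀ e ∈ walkEdges δ s m, e.1 ∈ Q := by
    refine walkEdges_fst_mem δ ⟨[], q, by simp⟩ ?_
    rintro ⟨r, x⟩ he ⟨q₁, q₂, hq, hr⟩
    rcases List.mem_append.1 (h.mem_iff.1 he) with he | he
    · obtain ⟨p₁, p₂, hp, hr'⟩ := (mem_walkEdges δ).1 he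
      exact absurd (by rw [hr, ← hr', one_mul]) (hcon p₁ _ q₁ q₂ hp hq)
    · obtain ⟨q₁, q₂, hq, hr'⟩ := (mem_walkEdges δ).1 he
      exact ⟨q₁ ++ [x], q₂, by simp [hq], by simp [← hr', mul_assoc]⟩
  obtain ⟨q₁, q₂, hq, hr⟩ := key (1, y) (h.mem_iff.2 (by simp))
  exact hcon [] _ q₁ q₂ rfl hq (by simp [hr])

/-- Two lists whose walks have the same labelled edges are connected by interchanges of two
factors `u`, `v` of equal degree `d` which enclose a factor of degree `d⁻¹`. -/
theorem walkEdges_perm_induction {P : List X → List X → Prop} (refl : ∀ l, P l l)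
    (trans : ∀ {l m k}, P l m → P m k → P l k) (cons : ∀ x {l m}, P l m → P (x :: l) (x :: m))
    (swap : ∀ {u t v} q, listDeg δ u = listDeg δ v → listDeg δ u * listDeg δ t = 1 →
      P (u ++ t ++ v ++ q) (v ++ t ++ u ++ q)) {l m : List X}
    (h : (walkEdges δ 1 l).Perm (walkEdges δ 1 m)) : P l m := by
  induction l generalizing m with
  | nil =>
    cases m with
    | nil => exact refl _
    | cons y m => simp at h
  | cons z l ih =>
    have same : ∀ {q}, (walkEdges δ 1 (z :: l)).Perm (walkEdges δ 1 (z :: q)) →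
        P (z :: l) (z :: q) := fun {q} hq => by
      simp only [walkEdges_cons, List.perm_cons] at hq
      exact cons z (ih ((walkEdges_perm_iff δ _ _ _ _).1 hq))
    -- The second word also uses the edge `(1, z)`, so it is `p z q` with `p` a loop at `1`. If `p`
    -- is empty, the heads agree and induction applies.
    obtain ⟨p, q, rfl, hpd⟩ := (mem_walkEdges δ).1 (h.mem_iff.1 List.mem_cons_self)
    rw [one_mul] at hpd
    by_cases hp : p = []
    · subst hp
      exact same h
    have h' := h
    rw [walkEdges_append, hpd, one_mul, walkEdges_cons, walkEdges_cons] at h'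
    replace h' := (h'.trans List.perm_middle).cons_inv
    rw [one_mul] at h'
    -- Without the edge `(1, z)`, the walk `l` sweeps the edges of `p` and `q`, so these share a
    -- vertex. Cutting there gives `p₁ p₂ (z q₁) q₂`, where `p₁` and `z q₁` have equal degree and
    -- `p₂` the inverse one. Interchanging `p₁` and `z q₁` brings `z` to the front.
    obtain ⟨p₁, p₂, q₁, q₂, rfl, rfl, hpq⟩ := exists_common_vertex δ hp h'
    rw [listDeg_append] at hpd
    have e1 : p₁ ++ p₂ ++ z :: (q₁ ++ q₂) = p₁ ++ p₂ ++ (z :: q₁) ++ q₂ := by simp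
    have d1 : listDeg δ (z :: q₁) = listDeg δ p₁ := by simp [hpq]
    rw [e1] at h ⊢
    refine trans ?_ (swap (u := z :: q₁) (t := p₂) (v := p₁) q₂ d1 (d1 ▸ hpd))
    simp only [List.cons_append]
    refine same (h.trans ?_)
    have := walkEdges_swap δ 1 q₂ d1.symm hpd
    simpa only [List.cons_append] using this

/-! ### Walks in a relation and coarsening -/

variable {δ} (E : G → G → Prop)

/-- The walk from `s` with the given steps only uses edges of the relation `E`. -/
def IsWalk : G → List G → Prop
  | _, [] => True
  | s, h :: t => E s (s * h) ∧ IsWalk (s * h) t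

@[simp] theorem isWalk_nil (s : G) : IsWalk E s [] := trivial

@[simp] theorem isWalk_cons (s h : G) (t : List G) :
    IsWalk E s (h :: t) ↔ E s (s * h) ∧ IsWalk E (s * h) t := Iff.rfl

theorem isWalk_map_iff (s : G) (l : List X) :
    IsWalk E s (l.map δ) ↔ ∀ e ∈ walkEdges δ s l, E e.1 (e.1 * δ e.2) := by
  induction l generalizing s with
  | nil => simp
  | cons x l ih => simp [ih]

/-- Here `A` is the set of vertices still alive. A letter that all of them survive joins the prefix
`u` and translates `A`. A letter that kills some vertex becomes a block of its own, and the prefix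
found for the survivors becomes at most one more block. Each drop of `A` thus costs at most two
blocks, and the last one costs a single block. The final clause records that the prefix is empty
when the first letter kills. -/
theorem exists_coarsening_from (w : List X) (A : Finset G) (hA : A.Nonempty)
    (h : ∀ a ∈ A, ¬ IsWalk E a (w.map δ)) :
    ∃ (u : List X) (c : List (List X)) (r : List X), w = u ++ c.flatten ++ r ∧
      c.length + 1 ≤ 2 * A.card ∧ (∀ b ∈ c, b ≠ []) ∧
      (∀ a ∈ A, ¬ IsWalk E (a * listDeg δ u) (c.map (listDeg δ))) ∧
      ((∃ a ∈ A, ∃ x w', w = x :: w' ∧ ¬ E a (a * δ x)) → u = []) := by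
  classical
  induction w generalizing A with
  | nil =>
    obtain ⟨a, ha⟩ := hA
    exact absurd (isWalk_nil E a) (h a ha)
  | cons x w ih =>
    by_cases hf : ∃ a ∈ A, ¬ E a (a * δ x)
    · obtain ⟨a₀, ha₀, hE⟩ := hf
      let A' := (A.filter fun a => E a (a * δ x)).image (· * δ x)
      have hcard : A'.card + 1 ≤ A.card := by
        refine (Nat.add_le_add_right Finset.card_image_le 1).trans ?_
        exact Finset.card_lt_card (Finset.filter_ssubset.2 ⟨a₀, ha₀, hE⟩)
      have hA' : ∀ a ∈ A, E a (a * δ x) → a * δ x ∈ A' := fun a ha hE =>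
        Finset.mem_image_of_mem _ (Finset.mem_filter.2 ⟨ha, hE⟩)
      rcases A'.eq_empty_or_nonempty with he | hne
      · refine ⟨[], [[x]], w, by simp, ?_, by simp, fun a ha hw => ?_, fun _ => rfl⟩
        · have := Finset.card_pos.2 ⟨a₀, ha₀⟩
          simp; omega
        · simp at hw
          simpa [he] using hA' a ha hw
      · obtain ⟨u, c, r, rfl, hc, hb, hw, -⟩ := ih A' hne (by
          intro b hb
          obtain ⟨a, ha, rfl⟩ := Finset.mem_image.1 hb
          rw [Finset.mem_filter] at ha
          exact fun hw => h a ha.1 ⟨ha.2, hw⟩)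
        by_cases hu : u = []
        · subst hu
          refine ⟨[], [x] :: c, r, by simp, ?_, by simpa using hb, fun a ha hw' => ?_, fun _ => rfl⟩
          · simp; omega
          · simp at hw'
            exact hw _ (hA' a ha hw'.1) (by simpa using hw'.2)
        · refine ⟨[], [x] :: u :: c, r, by simp, ?_, by simpa [hu] using hb, fun a ha hw' => ?_,
            fun _ => rfl⟩
          · simp; omega
          · simp at hw'
            exact hw _ (hA' a ha hw'.1) hw'.2.2
    · push Not at hf
      obtain ⟨u, c, r, rfl, hc, hb, hw, -⟩ := ih (A.image (· * δ x)) (hA.image _) (by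
        intro b hb
        obtain ⟨a, ha, rfl⟩ := Finset.mem_image.1 hb
        exact fun hw => h a ha ⟨hf a ha, hw⟩)
      refine ⟨x :: u, c, r, by simp, hc.trans (Nat.mul_le_mul_left 2 Finset.card_image_le), hb,
        fun a ha hw' => ?_, ?_⟩
      · exact hw _ (Finset.mem_image_of_mem _ ha) (by simpa [mul_assoc] using hw')
      · rintro ⟨a, ha, y, w', hy, hE⟩
        obtain ⟨rfl, -⟩ := List.cons.inj hy
        exact absurd (hf a ha) hE

/-- A list which reads no walk of a relation on a finite set of `n` vertices has a segment that
splits into at most `2 n - 1` blocks whose degrees read no walk. -/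
theorem exists_coarsening (A : Finset G) (hA : A.Nonempty) (hE : ∀ s t, E s t → t ∈ A)
    (w : List X) (h : ∀ a ∈ A, ¬ IsWalk E a (w.map δ)) :
    ∃ (u : List X) (c : List (List X)) (r : List X), w = u ++ c.flatten ++ r ∧
      c.length + 1 ≤ 2 * A.card ∧ (∀ b ∈ c, b ≠ []) ∧
      ∀ a ∈ A, ¬ IsWalk E a (c.map (listDeg δ)) := by
  classical
  induction w with
  | nil =>
    obtain ⟨a, ha⟩ := hA
    exact absurd (isWalk_nil E a) (h a ha)
  | cons x w ih =>
    by_cases hf : ∃ a ∈ A, ¬ E a (a * δ x)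
    · obtain ⟨a₀, ha₀, hE₀⟩ := hf
      obtain ⟨u, c, r, hw, hc, hb, hn, hu⟩ := exists_coarsening_from E (x :: w) A hA h
      obtain rfl := hu ⟨a₀, ha₀, x, w, rfl, hE₀⟩
      exact ⟨[], c, r, hw, hc, hb, by simpa using hn⟩
    · push Not at hf
      -- A letter that no vertex of `A` fails to read maps `A` injectively into itself, hence
      -- permutes it; the tail then fails from all of `A` and the letter can be discarded.
      have himg : A.image (· * δ x) = A := by
        refine Finset.eq_of_subset_of_card_le ?_ ?_
        · intro b hb
          obtain ⟨a, ha, rfl⟩ := Finset.mem_image.1 hb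
          exact hE _ _ (hf a ha)
        · rw [Finset.card_image_of_injective _ (mul_left_injective _)]
      obtain ⟨u, c, r, rfl, hc, hb, hn⟩ := ih (by
        intro b hb
        rw [← himg] at hb
        obtain ⟨a, ha, rfl⟩ := Finset.mem_image.1 hb
        exact fun hw => h a ha ⟨hf a ha, hw⟩)
      exact ⟨x :: u, c, r, by simp, hc, hb, hn⟩

end Walks

/-! ### Words and substitutions -/

section Words

variable {X : Type*}

/-- The list of letters of a nonempty word. -/
def letters (w : FreeSemigroup X) : List X := w.head :: w.tail

theorem letters_ne_nil (w : FreeSemigroup X) : letters w ≠ [] := List.cons_ne_nil _ _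

theorem lift_eq_prod_letters {A : Type*} [Monoid A] (a : X → A) (w : FreeSemigroup X) :
    FreeSemigroup.lift a w = ((letters w).map a).prod := by
  induction w with
  | ih1 x => simp [letters]
  | ih2 x w _ ih => rw [FreeSemigroup.lift_of_mul, ih]; simp [letters]

variable (F : Type*) [Field F] {H : Type*}

/-- The monomial given by a list of variables; the empty list gives `0`. -/
def listWord : List (H × ℕ) → FreeGraded F H
  | [] => 0
  | v :: l => word F ⟨v, l⟩

@[simp] theorem listWord_nil : listWord F ([] : List (H × ℕ)) = 0 := rfl

theorem word_eq_listWord (w : FreeSemigroup (H × ℕ)) : word F w = listWord F (letters w) := rfl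

theorem word_mul_word (v w : FreeSemigroup (H × ℕ)) : word F v * word F w = word F (v * w) := by
  simp [word, MonoidAlgebra.single_mul_single]

theorem listWord_append {l m : List (H × ℕ)} (hl : l ≠ []) (hm : m ≠ []) :
    listWord F (l ++ m) = listWord F l * listWord F m := by
  obtain ⟨x, l, rfl⟩ := List.exists_cons_of_ne_nil hl
  obtain ⟨y, m, rfl⟩ := List.exists_cons_of_ne_nil hm
  exact (word_mul_word F ⟨x, l⟩ ⟨y, m⟩).symm

theorem gvar_eq_listWord (h : H) (i : ℕ) : gvar F h i = listWord F [(h, i)] := rfl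

theorem gvar_mul_gvar (h k : H) (i j : ℕ) :
    gvar F h i * gvar F k j = listWord F [(h, i), (k, j)] :=
  word_mul_word F _ _

theorem gvar_mul_gvar_mul_gvar (h k m : H) (i j p : ℕ) :
    gvar F h i * gvar F k j * gvar F m p = listWord F [(h, i), (k, j), (m, p)] := by
  simp only [gvar, word_mul_word]
  rfl

theorem multilinearMonomial_eq_listWord {q : ℕ} (d : Fin (q + 1) → H) :
    multilinearMonomial F d = listWord F (List.ofFn fun k => (d k, (k : ℕ) + 1)) := by
  rw [List.ofFn_succ]
  rfl

variable {F}

theorem eq_sum_listWord (f : FreeGraded F H) :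
    f = ∑ w ∈ f.coeff.support, f.coeff w • listWord F (letters w) := by
  conv_lhs => rw [← MonoidAlgebra.sum_coeff_single f]
  refine Finset.sum_congr rfl fun w _ => ?_
  rw [← word_eq_listWord, word, MonoidAlgebra.smul_single', mul_one]

section Eval

variable {A : Type*} [NonUnitalRing A] [Module F A] [SMulCommClass F A A] [IsScalarTower F A A]
  (a : H × ℕ → A)

theorem evalAt_word (w : FreeSemigroup (H × ℕ)) :
    evalAt a (word F w) = FreeSemigroup.lift a w := by
  simp [evalAt, word]

theorem evalAt_gvar (h : H) (i : ℕ) : evalAt a (gvar F h i) = a (h, i) := by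
  rw [gvar, evalAt_word, FreeSemigroup.lift_of]

theorem evalAt_listWord_cons (v : H × ℕ) {l : List (H × ℕ)} (hl : l ≠ []) :
    evalAt a (listWord F (v :: l)) = a v * evalAt a (listWord F l) := by
  rw [← List.singleton_append, listWord_append F (by simp) hl, map_mul]
  exact congrArg (· * _) (evalAt_gvar a v.1 v.2)

theorem evalAt_unique (φ : FreeGraded F H →ₙₐ[F] A) (hφ : ∀ h i, φ (gvar F h i) = a (h, i)) :
    φ = evalAt a := by
  refine MonoidAlgebra.nonUnitalAlgHom_ext F fun w => ?_
  change φ (word F w) = evalAt a (word F w)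
  induction w with
  | ih1 v => exact (hφ v.1 v.2).trans (evalAt_gvar a v.1 v.2).symm
  | ih2 v w hv hw => rw [← word_mul_word, map_mul, map_mul, hv, hw]

theorem map_evalAt {A' : Type*} [NonUnitalRing A'] [Module F A'] [SMulCommClass F A' A']
    [IsScalarTower F A' A'] (φ : A →ₙₐ[F] A') (f : FreeGraded F H) :
    φ (evalAt a f) = evalAt (fun v => φ (a v)) f :=
  DFunLike.congr_fun (evalAt_unique (fun v => φ (a v)) (φ.comp (evalAt a))
    fun h i => congrArg φ (evalAt_gvar a h i)) f

end Eval

theorem evalAt_listWord {A : Type*} [Ring A] [Algebra F A] (a : H × ℕ → A) {l : List (H × ℕ)}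
    (hl : l ≠ []) : evalAt a (listWord F l) = (l.map a).prod := by
  obtain ⟨v, l, rfl⟩ := List.exists_cons_of_ne_nil hl
  exact (evalAt_word a _).trans (lift_eq_prod_letters a _)

theorem evalAt_listWord_subst (b : H × ℕ → List (H × ℕ)) {l : List (H × ℕ)}
    (hb : ∀ v ∈ l, b v ≠ []) :
    evalAt (fun v => listWord F (b v)) (listWord F l) = listWord F (l.map b).flatten := by
  induction l with
  | nil => simp
  | cons v l ih =>
    by_cases hl : l = []
    · subst hl
      simpa [gvar_eq_listWord] using evalAt_gvar (fun v => listWord F (b v)) v.1 v.2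
    · obtain ⟨y, l', rfl⟩ := List.exists_cons_of_ne_nil hl
      rw [evalAt_listWord_cons _ _ hl, ih fun v hv => hb v (List.mem_cons_of_mem _ hv),
        List.map_cons (l := y :: l'), List.flatten_cons,
        listWord_append F (hb v (by simp)) (by simp [hb y])]

end Words

/-! ### `T`-ideals -/

section TIdeals

variable {F : Type*} [Field F] {H : Type*} [Group H]

theorem lift_fst_eq_listDeg (w : FreeSemigroup (H × ℕ)) :
    FreeSemigroup.lift (Prod.fst : H × ℕ → H) w = listDeg Prod.fst (letters w) :=
  lift_eq_prod_letters _ _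

theorem listWord_mem_freeComponent (l : List (H × ℕ)) :
    listWord F l ∈ freeComponent F (listDeg Prod.fst l) := by
  cases l with
  | nil => exact Submodule.zero_mem _
  | cons v l => exact Submodule.subset_span ⟨⟨v, l⟩, lift_fst_eq_listDeg _, rfl⟩

theorem gvar_mem_freeComponent (h : H) (i : ℕ) : gvar F h i ∈ freeComponent F h := by
  simpa [gvar_eq_listWord] using listWord_mem_freeComponent (F := F) [(h, i)]

theorem freeComponent_mul_mem {h k : H} {f f' : FreeGraded F H} (hf : f ∈ freeComponent F h)
    (hf' : f' ∈ freeComponent F k) : f * f' ∈ freeComponent F (h * k) := by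
  induction hf using Submodule.span_induction with
  | zero => simp
  | add x y _ _ hx hy => rw [add_mul]; exact Submodule.add_mem _ hx hy
  | smul c x _ hx => rw [smul_mul_assoc]; exact Submodule.smul_mem _ _ hx
  | mem x hx =>
    obtain ⟨v, rfl, rfl⟩ := hx
    induction hf' using Submodule.span_induction with
    | zero => simp
    | add x y _ _ hx hy => rw [mul_add]; exact Submodule.add_mem _ hx hy
    | smul c x _ hx => rw [mul_smul_comm]; exact Submodule.smul_mem _ _ hx
    | mem y hy =>
      obtain ⟨w, rfl, rfl⟩ := hy
      exact Submodule.subset_span ⟨v * w, map_mul _ _ _, word_mul_word F v w⟩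

section Eval

variable {A : Type*} [NonUnitalRing A] [Module F A] [SMulCommClass F A A] [IsScalarTower F A A]
  {𝒜 : H → Submodule F A}

theorem evalAt_mem (hmul : ∀ h k, ∀ x ∈ 𝒜 h, ∀ y ∈ 𝒜 k, x * y ∈ 𝒜 (h * k)) {a : H × ℕ → A}
    (ha : ∀ v, a v ∈ 𝒜 v.1) {h : H} {f : FreeGraded F H} (hf : f ∈ freeComponent F h) :
    evalAt a f ∈ 𝒜 h := by
  induction hf using Submodule.span_induction with
  | zero => simp
  | add x y _ _ hx hy => rw [map_add]; exact Submodule.add_mem _ hx hy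
  | smul c x _ hx => rw [map_smul]; exact Submodule.smul_mem _ _ hx
  | mem x hx =>
    obtain ⟨w, rfl, rfl⟩ := hx
    rw [evalAt_word]
    induction w with
    | ih1 v => exact ha v
    | ih2 v w _ ih =>
      rw [map_mul, map_mul]
      exact hmul _ _ _ (ha v) _ ih

/-- A graded endomorphism followed by a homogeneous substitution is again a homogeneous
substitution. -/
theorem isTIdeal_gradedIdentities (hmul : ∀ h k, ∀ x ∈ 𝒜 h, ∀ y ∈ 𝒜 k, x * y ∈ 𝒜 (h * k)) :
    IsTIdeal (gradedIdentities (F := F) 𝒜) where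
  mul_left_mem f f' hf' a ha := by rw [map_mul, hf' a ha, mul_zero]
  mul_right_mem f f' hf' a ha := by rw [map_mul, hf' a ha, zero_mul]
  map_mem φ hφ f hf a ha := by
    have := DFunLike.congr_fun (evalAt_unique (fun v => evalAt a (φ (gvar F v.1 v.2)))
      ((evalAt a).comp φ) fun h i => rfl) f
    exact this.trans (hf _ fun v => evalAt_mem hmul ha (hφ _ _ (gvar_mem_freeComponent _ _)))

end Eval

theorem isTIdeal_tIdealSpan (S : Set (FreeGraded F H)) : IsTIdeal (tIdealSpan S) where
  mul_left_mem a f hf := by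
    simp only [tIdealSpan, Submodule.mem_sInf] at hf ⊢
    exact fun I hI => hI.1.mul_left_mem a f (hf I hI)
  mul_right_mem a f hf := by
    simp only [tIdealSpan, Submodule.mem_sInf] at hf ⊢
    exact fun I hI => hI.1.mul_right_mem a f (hf I hI)
  map_mem φ hφ f hf := by
    simp only [tIdealSpan, Submodule.mem_sInf] at hf ⊢
    exact fun I hI => hI.1.map_mem φ hφ f (hf I hI)

theorem subset_tIdealSpan (S : Set (FreeGraded F H)) : S ⊆ tIdealSpan S := fun f hf => by
  simp only [tIdealSpan, SetLike.mem_coe, Submodule.mem_sInf]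
  exact fun I hI => hI.2 hf

theorem tIdealSpan_le {S : Set (FreeGraded F H)} {I : Submodule F (FreeGraded F H)}
    (hI : IsTIdeal I) (h : S ⊆ I) : tIdealSpan S ≤ I := sInf_le ⟨hI, h⟩

namespace IsTIdeal

variable {I : Submodule F (FreeGraded F H)}

theorem evalAt_mem (hI : IsTIdeal I) {a : H × ℕ → FreeGraded F H} (ha : ∀ v, a v ∈ freeComponent F v.1)
    {f : FreeGraded F H} (hf : f ∈ I) : evalAt a f ∈ I :=
  hI.map_mem (evalAt a) (fun _ _ hf => GradedPI.evalAt_mem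
    (fun _ _ _ hx _ hy => freeComponent_mul_mem hx hy) ha hf) f hf

/-- The substitution of the list `c i` for the variable of index `i` and of the same degree. -/
theorem exists_subst (hI : IsTIdeal I) (c : ℕ → List (H × ℕ)) : ∃ φ : FreeGraded F H →ₙₐ[F] FreeGraded F H,
    (∀ f ∈ I, φ f ∈ I) ∧ ∀ l : List (H × ℕ),
      (∀ v ∈ l, c v.2 ≠ [] ∧ listDeg Prod.fst (c v.2) = v.1) →
      φ (listWord F l) = listWord F (l.map fun v => c v.2).flatten := by
  classical
  -- Variables of the wrong degree go to the empty list, that is to `0`, which lies in every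
  -- component; this keeps the substitution graded.
  let b : H × ℕ → List (H × ℕ) := fun v => if listDeg Prod.fst (c v.2) = v.1 then c v.2 else []
  refine ⟨evalAt fun v => listWord F (b v), fun f hf => hI.evalAt_mem (fun v => ?_) hf,
    fun l hl => ?_⟩
  · by_cases hv : listDeg Prod.fst (c v.2) = v.1
    · simp only [b, if_pos hv]
      exact hv ▸ listWord_mem_freeComponent _
    · simp [b, hv]
  · have hb : ∀ v ∈ l, b v = c v.2 := fun v hv => if_pos (hl v hv).2
    rw [evalAt_listWord_subst b fun v hv => hb v hv ▸ (hl v hv).1, List.map_congr_left hb]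

/-- `T`-ideals absorb prefixes and suffixes, also the empty ones. -/
theorem listWord_context (hI : IsTIdeal I) {l : List (H × ℕ)} (hl : l ≠ []) (h : listWord F l ∈ I)
    (p q : List (H × ℕ)) : listWord F (p ++ l ++ q) ∈ I := by
  have h1 : listWord F (p ++ l) ∈ I := by
    by_cases hp : p = []
    · simpa [hp] using h
    · rw [listWord_append F hp hl]; exact hI.mul_left_mem _ _ h
  by_cases hq : q = []
  · simpa [hq] using h1
  · rw [listWord_append F (by simp [hl]) hq]; exact hI.mul_right_mem _ _ h1

theorem listWord_sub_context (hI : IsTIdeal I) {l m : List (H × ℕ)} (hl : l ≠ []) (hm : m ≠ []) (ε : F)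
    (h : listWord F l - ε • listWord F m ∈ I) (p q : List (H × ℕ)) :
    listWord F (p ++ l ++ q) - ε • listWord F (p ++ m ++ q) ∈ I := by
  have h1 : listWord F (p ++ l) - ε • listWord F (p ++ m) ∈ I := by
    by_cases hp : p = []
    · simpa [hp] using h
    · rw [listWord_append F hp hl, listWord_append F hp hm, ← mul_smul_comm, ← mul_sub]
      exact hI.mul_left_mem _ _ h
  by_cases hq : q = []
  · simpa [hq] using h1
  · rw [listWord_append F (by simp [hl]) hq, listWord_append F (by simp [hm]) hq,
      ← smul_mul_assoc, ← sub_mul]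
    exact hI.mul_right_mem _ _ h1

end IsTIdeal

end TIdeals

/-! ### Parities and Koszul signs -/

section Parity

variable {G : Type*}

/-- The `G`-degree of a variable. -/
def varDeg (v : SuperDeg G × ℕ) : G := v.1.1

/-- The parity of a variable. -/
def varParity (v : SuperDeg G × ℕ) : ZMod 2 := v.1.2.toAdd

/-- The parity of a list of variables. -/
def listParity (l : List (SuperDeg G × ℕ)) : ZMod 2 := (l.map varParity).sum

@[simp] theorem listParity_nil : listParity ([] : List (SuperDeg G × ℕ)) = 0 := rfl

@[simp] theorem listParity_cons (v : SuperDeg G × ℕ) (l : List (SuperDeg G × ℕ)) :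
    listParity (v :: l) = varParity v + listParity l := by
  simp [listParity]

theorem listDeg_fst_eq [Group G] (l : List (SuperDeg G × ℕ)) :
    listDeg Prod.fst l = (listDeg varDeg l, Multiplicative.ofAdd (listParity l)) := by
  induction l with
  | nil => rfl
  | cons v l ih => simp [ih, varDeg, varParity, Prod.ext_iff]

theorem zmod_two_eq_zero_or_one (a : ZMod 2) : a = 0 ∨ a = 1 := by
  revert a; decide

variable (F : Type*) [Field F]

/-- The sign which arises when elements of parities `a` and `b` are interchanged. -/
def koszulSign (a b : ZMod 2) : F := if a = 1 ∧ b = 1 then -1 else 1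

/-- The sign which arises when the order of three elements of parities `a`, `c`, `b` is
reversed. -/
def reversalSign (a c b : ZMod 2) : F := koszulSign F a c * koszulSign F a b * koszulSign F c b

@[simp] theorem koszulSign_zero_left (b : ZMod 2) : koszulSign F 0 b = 1 := by simp [koszulSign]

@[simp] theorem koszulSign_zero_right (b : ZMod 2) : koszulSign F b 0 = 1 := by simp [koszulSign]

@[simp] theorem koszulSign_one_one : koszulSign F 1 1 = -1 := by simp [koszulSign]

theorem koszulSign_comm (a b : ZMod 2) : koszulSign F a b = koszulSign F b a := by
  simp [koszulSign, and_comm]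

theorem koszulSign_mul_self (a b : ZMod 2) : koszulSign F a b * koszulSign F a b = 1 := by
  unfold koszulSign; split_ifs <;> simp

theorem reversalSign_comm (a c b : ZMod 2) : reversalSign F a c b = reversalSign F b c a := by
  simp only [reversalSign, koszulSign_comm F b, koszulSign_comm F c a]; ring

theorem reversalSign_mul_self (a c b : ZMod 2) :
    reversalSign F a c b * reversalSign F a c b = 1 := by
  have h := koszulSign_mul_self F
  calc _ = (koszulSign F a c * koszulSign F a c) * (koszulSign F a b * koszulSign F a b) *
        (koszulSign F c b * koszulSign F c b) := by unfold reversalSign; ring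
    _ = 1 := by simp [h]

end Parity

/-! ### Interchanging factors modulo a `T`-ideal -/

section Interchange

variable {F : Type*} [Field F] {G : Type*} {I : Submodule F (FreeGraded F (SuperDeg G))}

/-- The list `l` may be replaced by `ε` times the list `m` in all contexts modulo `I`. -/
def ReplaceMod (I : Submodule F (FreeGraded F (SuperDeg G))) (ε : F)
    (l m : List (SuperDeg G × ℕ)) : Prop :=
  ∀ p q, listWord F (p ++ l ++ q) - ε • listWord F (p ++ m ++ q) ∈ I

namespace ReplaceMod

theorem refl (l : List (SuperDeg G × ℕ)) : ReplaceMod I 1 l l := fun p q => by simp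

theorem trans {ε ε' : F} {l m k : List (SuperDeg G × ℕ)} (h : ReplaceMod I ε l m)
    (h' : ReplaceMod I ε' m k) : ReplaceMod I (ε * ε') l k := fun p q => by
  have := I.add_mem (h p q) (I.smul_mem ε (h' p q))
  rwa [smul_sub, sub_add_sub_cancel, smul_smul] at this

theorem context {ε : F} {l m : List (SuperDeg G × ℕ)} (h : ReplaceMod I ε l m)
    (p q : List (SuperDeg G × ℕ)) : ReplaceMod I ε (p ++ l ++ q) (p ++ m ++ q) := fun p' q' => by
  simpa only [List.append_assoc] using h (p' ++ p) (q ++ q')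

theorem listWord_sub_mem {ε : F} {l m : List (SuperDeg G × ℕ)} (h : ReplaceMod I ε l m) :
    listWord F l - ε • listWord F m ∈ I := by
  simpa using h [] []

theorem symm {ε : F} (hε : ε * ε = 1) {l m : List (SuperDeg G × ℕ)}
    (h : ReplaceMod I ε l m) : ReplaceMod I ε m l := fun p q => by
  have := I.smul_mem (-ε) (h p q)
  rwa [smul_sub, smul_smul, neg_mul, hε, neg_smul, neg_smul, one_smul, sub_neg_eq_add,
    neg_add_eq_sub] at this

end ReplaceMod

variable [Group G] {G₀ : Set G}

theorem listWord_mem_of_degree_not_mem (hI : IsTIdeal I)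
    (hS : ∀ f, SuperizedPolynomial F G₀ f → f ∈ I) {u : List (SuperDeg G × ℕ)} (hu : u ≠ [])
    (h : listDeg varDeg u ∉ G₀) : listWord F u ∈ I := by
  obtain ⟨φ, hφ, hφl⟩ := hI.exists_subst fun _ => u
  have h1 := hφ _ (hS _ (.single _ h (listParity u)))
  rwa [zvar, gvar_eq_listWord, hφl _ (by simp [hu, listDeg_fst_eq]), List.map_singleton,
    List.flatten_singleton] at h1

theorem replaceMod_of_degree_not_mem (hI : IsTIdeal I)
    (hS : ∀ f, SuperizedPolynomial F G₀ f → f ∈ I) {u v t : List (SuperDeg G × ℕ)} (hu : u ≠ [])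
    (h : listDeg varDeg u ∉ G₀) (ε : F) :
    ReplaceMod I ε (u ++ t ++ v) (v ++ t ++ u) := fun p q => by
  have h1 := listWord_mem_of_degree_not_mem hI hS hu h
  refine I.sub_mem ?_ (I.smul_mem _ ?_)
  · simpa only [List.append_assoc] using hI.listWord_context hu h1 p (t ++ v ++ q)
  · simpa only [List.append_assoc] using hI.listWord_context hu h1 (p ++ v ++ t) q

theorem replaceMod_reverse_three (hI : IsTIdeal I) {h : G} {ε : F} {u t v : List (SuperDeg G × ℕ)}
    (hu : u ≠ []) (ht : t ≠ []) (hv : v ≠ []) (hud : listDeg varDeg u = h)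
    (htd : listDeg varDeg t = h⁻¹) (hvd : listDeg varDeg v = h)
    (H : listWord F [((h, Multiplicative.ofAdd (listParity u)), 1),
        ((h⁻¹, Multiplicative.ofAdd (listParity t)), 2),
        ((h, Multiplicative.ofAdd (listParity v)), 3)] -
      ε • listWord F [((h, Multiplicative.ofAdd (listParity v)), 3),
        ((h⁻¹, Multiplicative.ofAdd (listParity t)), 2),
        ((h, Multiplicative.ofAdd (listParity u)), 1)] ∈ I) :
    ReplaceMod I ε (u ++ t ++ v) (v ++ t ++ u) := by
  obtain ⟨φ, hφ, hφl⟩ := hI.exists_subst fun i => if i = 1 then u else if i = 2 then t else v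
  have h1 := hφ _ H
  rw [map_sub, map_smul, hφl _ (by simp [hu, ht, hv, listDeg_fst_eq, hud, htd, hvd]),
    hφl _ (by simp [hu, ht, hv, listDeg_fst_eq, hud, htd, hvd])] at h1
  exact hI.listWord_sub_context (by simp [hu]) (by simp [hv]) ε (by simpa using h1)

theorem replaceMod_reverse_two (hI : IsTIdeal I) {ε : F} {u v : List (SuperDeg G × ℕ)}
    (hu : u ≠ []) (hv : v ≠ []) (hud : listDeg varDeg u = 1) (hvd : listDeg varDeg v = 1)
    (H : listWord F [((1, Multiplicative.ofAdd (listParity u)), 1),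
        ((1, Multiplicative.ofAdd (listParity v)), 2)] -
      ε • listWord F [((1, Multiplicative.ofAdd (listParity v)), 2),
        ((1, Multiplicative.ofAdd (listParity u)), 1)] ∈ I) :
    ReplaceMod I ε (u ++ v) (v ++ u) := by
  obtain ⟨φ, hφ, hφl⟩ := hI.exists_subst fun i => if i = 1 then u else v
  have h1 := hφ _ H
  rw [map_sub, map_smul, hφl _ (by simp [hu, hv, listDeg_fst_eq, hud, hvd]),
    hφl _ (by simp [hu, hv, listDeg_fst_eq, hud, hvd])] at h1
  exact hI.listWord_sub_context (by simp [hu]) (by simp [hv]) ε (by simpa using h1)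

theorem replaceMod_comm (hI : IsTIdeal I) (hS : ∀ f, SuperizedPolynomial F G₀ f → f ∈ I)
    {u v : List (SuperDeg G × ℕ)} (hud : listDeg varDeg u = 1) (hvd : listDeg varDeg v = 1) :
    ReplaceMod I (koszulSign F (listParity u) (listParity v)) (u ++ v) (v ++ u) := by
  by_cases hu : u = []
  · subst hu; simpa using ReplaceMod.refl v
  by_cases hv : v = []
  · subst hv; simpa using ReplaceMod.refl u
  by_cases he : (1 : G) ∈ G₀
  swap
  · simpa using replaceMod_of_degree_not_mem hI hS (v := v) (t := []) hu (hud ▸ he) _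
  rcases zmod_two_eq_zero_or_one (listParity u) with ha | ha
  · refine replaceMod_reverse_two hI hu hv hud hvd ?_
    rw [ha]
    simpa [xvar, zvar, gvar_mul_gvar] using hS _ (.comm_xz he (listParity v))
  rcases zmod_two_eq_zero_or_one (listParity v) with hb | hb
  -- An odd factor before an even one: the listed relation has the even variable first, so it is
  -- read backwards.
  · rw [koszulSign_comm]
    refine ReplaceMod.symm (koszulSign_mul_self F _ _)
      (replaceMod_reverse_two hI hv hu hvd hud ?_)
    rw [hb]
    simpa [xvar, zvar, gvar_mul_gvar] using hS _ (.comm_xz he (listParity u))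
  · refine replaceMod_reverse_two hI hu hv hud hvd ?_
    rw [ha, hb]
    simpa [yvar, zvar, gvar_mul_gvar] using hS _ (.comm_yy he)

/-- Two factors of equal degree `h` which enclose a factor of degree `h⁻¹` may be interchanged. -/
theorem replaceMod_reverse (hI : IsTIdeal I) (hS : ∀ f, SuperizedPolynomial F G₀ f → f ∈ I)
    {u t v : List (SuperDeg G × ℕ)} (huv : listDeg varDeg u = listDeg varDeg v)
    (hut : listDeg varDeg u * listDeg varDeg t = 1) :
    ReplaceMod I (reversalSign F (listParity u) (listParity t) (listParity v))
      (u ++ t ++ v) (v ++ t ++ u) := by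
  obtain ⟨h, hh⟩ : ∃ h, listDeg varDeg u = h := ⟨_, rfl⟩
  have hv : listDeg varDeg v = h := huv ▸ hh
  have ht : listDeg varDeg t = h⁻¹ := (inv_eq_of_mul_eq_one_right (hh ▸ hut)).symm
  -- In degree `1` all three factors commute up to Koszul signs, and three transpositions reverse
  -- them.
  by_cases h1 : h = 1
  · subst h1
    rw [inv_one] at ht
    have c1 := (replaceMod_comm hI hS hh ht).context [] v
    have c2 := (replaceMod_comm hI hS hh hv).context t []
    have c3 := (replaceMod_comm hI hS ht hv).context [] u
    simp only [List.append_assoc, List.append_nil, List.nil_append] at c1 c2 c3 ⊢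
    exact (c1.trans c2).trans c3
  have hu' : u ≠ [] := by rintro rfl; exact h1 hh.symm
  have hv' : v ≠ [] := by rintro rfl; exact h1 hv.symm
  have ht' : t ≠ [] := by rintro rfl; exact h1 (inv_eq_one.1 ht.symm)
  by_cases hG : h ∈ G₀
  swap
  · exact replaceMod_of_degree_not_mem hI hS hu' (hh ▸ hG) _
  -- The listed relations cover every parity pattern except an even first factor with an odd third
  -- one; that case follows by reading a relation backwards.
  have key : ∀ {u v : List (SuperDeg G × ℕ)}, u ≠ [] → v ≠ [] → listDeg varDeg u = h →
      listDeg varDeg v = h → (listParity v = 1 → listParity u = 1) →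
      ReplaceMod I (reversalSign F (listParity u) (listParity t) (listParity v))
        (u ++ t ++ v) (v ++ t ++ u) := by
    intro u v hu' hv' hh hv huv
    refine replaceMod_reverse_three hI hu' ht' hv' hh ht hv ?_
    rcases zmod_two_eq_zero_or_one (listParity v) with hb | hb
    · rcases zmod_two_eq_zero_or_one (listParity t) with hc | hc
      · rw [hb, hc]
        simpa [xvar, zvar, gvar_mul_gvar_mul_gvar, reversalSign] using
          hS _ (.zxx h h1 hG (listParity u))
      · rcases zmod_two_eq_zero_or_one (listParity u) with ha | ha
        · rw [ha, hb, hc]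
          simpa [xvar, yvar, zvar, gvar_mul_gvar_mul_gvar, reversalSign] using
            hS _ (.xyx h h1 hG)
        · rw [ha, hb, hc]
          simpa [xvar, yvar, zvar, gvar_mul_gvar_mul_gvar, reversalSign] using
            hS _ (.yyx h h1 hG)
    · rcases zmod_two_eq_zero_or_one (listParity t) with hc | hc
      · rw [huv hb, hb, hc]
        simpa [xvar, yvar, zvar, gvar_mul_gvar_mul_gvar, reversalSign] using
          hS _ (.yxy h h1 hG)
      · rw [huv hb, hb, hc]
        simpa [xvar, yvar, zvar, gvar_mul_gvar_mul_gvar, reversalSign] using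
          hS _ (.yyy h h1 hG)
  by_cases hp : listParity v = 1 → listParity u = 1
  · exact key hu' hv' hh hv hp
  · rw [reversalSign_comm]
    refine ReplaceMod.symm (reversalSign_mul_self F _ _ _) (key hv' hu' hv hh fun _ => ?_)
    exact (Classical.not_imp.1 hp).1

theorem exists_split_of_sublist_walkEdges {X : Type*} (δ : X → G) {r s : G} {x : X} {l : List X}
    (h : [(r, x), (r, x)].Sublist (walkEdges δ s l)) :
    ∃ p t q, l = p ++ ([x] ++ t ++ [x]) ++ q ∧ δ x * listDeg δ t = 1 := by
  induction l generalizing s with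
  | nil => simp at h
  | cons y l ih =>
    rw [walkEdges_cons] at h
    cases h with
    | cons _ h =>
      obtain ⟨p, t, q, rfl, ht⟩ := ih h
      exact ⟨y :: p, t, q, by simp, ht⟩
    | cons_cons _ h =>
      obtain ⟨p, q, rfl, hp⟩ := (mem_walkEdges δ).1 (List.singleton_sublist.1 h)
      exact ⟨[], p, q, by simp, by simpa [mul_assoc] using hp⟩

/-- A word whose walk uses a labelled edge with an odd label twice lies in the ideal. -/
theorem listWord_mem_of_repeated_odd [CharZero F] (hI : IsTIdeal I)
    (hS : ∀ f, SuperizedPolynomial F G₀ f → f ∈ I) {l : List (SuperDeg G × ℕ)} {r s : G}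
    {x : SuperDeg G × ℕ} (hx : varParity x = 1)
    (h : [(r, x), (r, x)].Sublist (walkEdges varDeg s l)) : listWord F l ∈ I := by
  obtain ⟨p, t, q, rfl, ht⟩ := exists_split_of_sublist_walkEdges _ h
  have h1 := replaceMod_reverse hI hS (u := [x]) (t := t) (v := [x]) rfl (by simpa using ht) p q
  -- Interchanging the two copies of `x` gives back the same word. The two passages across `t`
  -- cancel in sign and the odd `x` passes itself with `-1`, so twice the word lies in `I`.
  have hε : reversalSign F (listParity [x]) (listParity t) (listParity [x]) = -1 := by
    rw [reversalSign, koszulSign_comm F (listParity t), mul_right_comm, koszulSign_mul_self]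
    simp [hx]
  rw [hε, neg_one_smul, sub_neg_eq_add, ← two_smul F] at h1
  exact (I.smul_mem_iff (two_ne_zero' F)).1 h1

end Interchange

/-! ### The Grassmann algebra -/

section Grassmann

variable {F V : Type*} [Field F] [AddCommGroup V] [Module F V]

theorem one_mem_grassmannComponent : (1 : ExteriorAlgebra F V) ∈ grassmannComponent F V 0 :=
  SetLike.GradedOne.one_mem (A := CliffordAlgebra.evenOdd (0 : QuadraticForm F V))

theorem mul_mem_grassmannComponent {a b : ZMod 2} {x y : ExteriorAlgebra F V}
    (hx : x ∈ grassmannComponent F V a) (hy : y ∈ grassmannComponent F V b) :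
    x * y ∈ grassmannComponent F V (a + b) :=
  SetLike.GradedMul.mul_mem (A := CliffordAlgebra.evenOdd (0 : QuadraticForm F V)) hx hy

theorem ι_mem_grassmannComponent (v : V) : ExteriorAlgebra.ι F v ∈ grassmannComponent F V 1 :=
  CliffordAlgebra.ι_mem_evenOdd_one (0 : QuadraticForm F V) v

theorem koszulSign_add_left (a b c : ZMod 2) :
    koszulSign F (a + b) c = koszulSign F a c * koszulSign F b c := by
  rcases zmod_two_eq_zero_or_one a with rfl | rfl <;>
  rcases zmod_two_eq_zero_or_one b with rfl | rfl <;>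
  rcases zmod_two_eq_zero_or_one c with rfl | rfl <;> simp [show (1 + 1 : ZMod 2) = 0 from rfl]

/-- Homogeneous elements arise from scalars by sums and by left multiplication with vectors, each of
which flips the parity. -/
theorem grassmannComponent_induction {P : ZMod 2 → ExteriorAlgebra F V → Prop}
    (algebraMap : ∀ r, P 0 (algebraMap F _ r)) (add : ∀ a x y, P a x → P a y → P a (x + y))
    (ι_mul : ∀ a v x, P a x → P (1 + a) (ExteriorAlgebra.ι F v * x)) {a : ZMod 2}
    {x : ExteriorAlgebra F V} (hx : x ∈ grassmannComponent F V a) : P a x := by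
  induction hx using Submodule.iSup_induction' with
  | mem i x hx =>
    obtain ⟨i, rfl⟩ := i
    dsimp only at hx ⊢
    induction hx using Submodule.pow_induction_on_left' with
    | algebraMap r => simpa using algebraMap r
    | add x y i hx hy ihx ihy => exact add _ _ _ ihx ihy
    | mem_mul m hm i x hx ih =>
      obtain ⟨v, rfl⟩ := hm
      simpa [add_comm] using ι_mul _ v x ih
  | zero =>
    rcases zmod_two_eq_zero_or_one a with rfl | rfl
    · simpa using algebraMap 0
    · simpa using ι_mul 0 0 _ (algebraMap 0)
  | add x y hx hy ihx ihy => exact add _ _ _ ihx ihy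

theorem ι_mul_eq_koszulSign {b : ZMod 2} (v : V) {y : ExteriorAlgebra F V}
    (hy : y ∈ grassmannComponent F V b) :
    ExteriorAlgebra.ι F v * y = koszulSign F 1 b • (y * ExteriorAlgebra.ι F v) := by
  refine grassmannComponent_induction (P := fun b y =>
    ExteriorAlgebra.ι F v * y = koszulSign F 1 b • (y * ExteriorAlgebra.ι F v))
    (fun r => ?_) (fun a x y hx hy => ?_) (fun a w x ih => ?_) hy
  · simpa using (Algebra.commutes r _).symm
  · rw [mul_add, hx, hy, add_mul, smul_add]
  · rw [koszulSign_comm, koszulSign_add_left, koszulSign_comm F a, koszulSign_one_one, neg_one_mul,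
      neg_smul, mul_assoc, ← mul_smul_comm, ← ih, ← mul_assoc, ← mul_assoc, ← neg_mul,
      eq_neg_of_add_eq_zero_left (ExteriorAlgebra.ι_add_mul_swap v w)]

theorem mul_eq_koszulSign {a b : ZMod 2} {x y : ExteriorAlgebra F V}
    (hx : x ∈ grassmannComponent F V a) (hy : y ∈ grassmannComponent F V b) :
    x * y = koszulSign F a b • (y * x) := by
  refine grassmannComponent_induction (P := fun a x => x * y = koszulSign F a b • (y * x))
    (fun r => ?_) (fun a x z hx hz => ?_) (fun a w x ih => ?_) hx
  · simpa using Algebra.commutes r y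
  · rw [add_mul, hx, hz, mul_add, smul_add]
  · rw [koszulSign_add_left, mul_assoc, ih, mul_smul_comm, ← mul_assoc, ι_mul_eq_koszulSign w hy,
      smul_mul_assoc, smul_smul, mul_assoc, mul_comm (koszulSign F a b)]

theorem mul_mul_eq_reversalSign {a c b : ZMod 2} {x y z : ExteriorAlgebra F V}
    (hx : x ∈ grassmannComponent F V a) (hz : z ∈ grassmannComponent F V c)
    (hy : y ∈ grassmannComponent F V b) :
    x * z * y = reversalSign F a c b • (y * z * x) := by
  rw [mul_eq_koszulSign hx hz, smul_mul_assoc, mul_assoc, mul_eq_koszulSign hx hy, mul_smul_comm,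
    smul_smul, ← mul_assoc, mul_eq_koszulSign hz hy, smul_mul_assoc, smul_smul, reversalSign]

/-- The wedge of all members of a finite independent family belongs to a linearly independent family
in the top exterior power considered, hence is nonzero. -/
theorem prod_ι_ne_zero {b : ℕ → V} (hb : LinearIndependent F b) {l : List ℕ} (hl : l.Nodup) :
    (l.map fun i => ExteriorAlgebra.ι F (b i)).prod ≠ 0 := by
  have hv : LinearIndependent F fun i : Fin l.length => b (l.get i) :=
    hb.comp _ (List.nodup_iff_injective_get.1 hl)
  have h1 := (exteriorPower.ιMulti_family_linearIndependent_field (n := l.length) hv).ne_zero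
    (Set.powersetCard.ofFinEmbEquiv (RelEmbedding.refl _))
  intro h0
  refine h1 (Subtype.ext ?_)
  simp only [exteriorPower.ιMulti_family, exteriorPower.ιMulti_apply_coe, ZeroMemClass.coe_zero,
    ExteriorAlgebra.ιMulti_apply, Equiv.symm_apply_apply]
  rw [← h0]
  congr 1
  exact List.ext_get (by simp) fun i hi hi' => by simp

end Grassmann

/-! ### Weights of walks -/

section Weights

variable {F V G : Type*} [Field F] [AddCommGroup V] [Module F V] [Group G]

section

variable {X K : Type*} [Monoid K] (δ : X → G) (θ : G × X → K)

/-- The product of the weights of the edges of the walk from `s` which reads `l`. -/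
def walkWeight (s : G) (l : List X) : K := ((walkEdges δ s l).map θ).prod

@[simp] theorem walkWeight_nil (s : G) : walkWeight δ θ s [] = 1 := rfl

@[simp] theorem walkWeight_cons (s : G) (v : X) (l : List X) :
    walkWeight δ θ s (v :: l) = θ (s, v) * walkWeight δ θ (s * δ v) l := by
  simp [walkWeight]

theorem walkWeight_append (s : G) (l m : List X) :
    walkWeight δ θ s (l ++ m) = walkWeight δ θ s l * walkWeight δ θ (s * listDeg δ l) m := by
  simp [walkWeight, walkEdges_append]

end

/-- A weight of labelled edges which respects the parities of the labels. -/
def IsGradedWeight (θ : G × SuperDeg G × ℕ → ExteriorAlgebra F V) : Prop :=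
  ∀ e, θ e ∈ grassmannComponent F V (varParity e.2)

variable {θ : G × SuperDeg G × ℕ → ExteriorAlgebra F V}

theorem IsGradedWeight.walkWeight_mem (hθ : IsGradedWeight θ) (s : G)
    (l : List (SuperDeg G × ℕ)) : walkWeight varDeg θ s l ∈ grassmannComponent F V (listParity l) := by
  induction l generalizing s with
  | nil => exact one_mem_grassmannComponent
  | cons v l ih =>
    rw [walkWeight_cons, listParity_cons]
    exact mul_mem_grassmannComponent (hθ (s, v)) (ih _)

/-- Each piece keeps its start vertex, as in `walkEdges_swap`, so only three homogeneous factors of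
the weight are reversed. -/
theorem IsGradedWeight.walkWeight_reverse (hθ : IsGradedWeight θ) (s : G)
    {u t v : List (SuperDeg G × ℕ)} (q : List (SuperDeg G × ℕ))
    (huv : listDeg varDeg u = listDeg varDeg v) (hut : listDeg varDeg u * listDeg varDeg t = 1) :
    walkWeight varDeg θ s (u ++ t ++ v ++ q) =
      reversalSign F (listParity u) (listParity t) (listParity v) •
        walkWeight varDeg θ s (v ++ t ++ u ++ q) := by
  have hvt : listDeg varDeg v * listDeg varDeg t = 1 := huv ▸ hut
  simp only [walkWeight_append, listDeg_append, hvt, huv, mul_one]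
  rw [mul_mul_eq_reversalSign (hθ.walkWeight_mem _ _) (hθ.walkWeight_mem _ _)
    (hθ.walkWeight_mem _ _), smul_mul_assoc]

/-- Words with the same labelled edges agree up to a sign modulo the ideal, and their weights
agree up to the same sign. -/
theorem exists_sign_of_walkEdges_perm {I : Submodule F (FreeGraded F (SuperDeg G))}
    (hI : IsTIdeal I) {G₀ : Set G} (hS : ∀ f, SuperizedPolynomial F G₀ f → f ∈ I)
    {l m : List (SuperDeg G × ℕ)} (h : (walkEdges varDeg 1 l).Perm (walkEdges varDeg 1 m)) :
    ∃ ε : F, listWord F l - ε • listWord F m ∈ I ∧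
      ∀ θ : G × SuperDeg G × ℕ → ExteriorAlgebra F V, IsGradedWeight θ → ∀ s,
        walkWeight varDeg θ s l = ε • walkWeight varDeg θ s m := by
  -- Replacement in all contexts is what survives prefixing a letter in the induction; one `ε` has
  -- to serve both the words and their weights.
  suffices H : ∃ ε : F, ReplaceMod I ε l m ∧
      ∀ θ : G × SuperDeg G × ℕ → ExteriorAlgebra F V, IsGradedWeight θ → ∀ s,
        walkWeight varDeg θ s l = ε • walkWeight varDeg θ s m by
    obtain ⟨ε, h1, h2⟩ := H
    exact ⟨ε, h1.listWord_sub_mem, h2⟩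
  refine walkEdges_perm_induction varDeg (P := fun l m => ∃ ε : F, ReplaceMod I ε l m ∧
      ∀ θ : G × SuperDeg G × ℕ → ExteriorAlgebra F V, IsGradedWeight θ → ∀ s,
        walkWeight varDeg θ s l = ε • walkWeight varDeg θ s m)
    (fun l => ⟨1, .refl l, by simp⟩) ?_ ?_ ?_ h
  · rintro l m k ⟨ε, h1, h2⟩ ⟨ε', h1', h2'⟩
    exact ⟨ε * ε', h1.trans h1', fun θ hθ s => by rw [h2 θ hθ, h2' θ hθ, smul_smul]⟩
  · rintro x l m ⟨ε, h1, h2⟩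
    refine ⟨ε, by simpa using h1.context [x] [], fun θ hθ s => ?_⟩
    rw [walkWeight_cons, walkWeight_cons, h2 θ hθ, mul_smul_comm]
  · intro u t v q huv hut
    exact ⟨_, by simpa using (replaceMod_reverse hI hS huv hut).context [] q,
      fun θ hθ s => hθ.walkWeight_reverse s q huv hut⟩

end Weights

/-! ### Weight matrices -/

section WeightMatrices

variable {X G K : Type*} [Ring K] {n : ℕ} (g : Fin n → G) (δ : X → G)

open scoped Classical in
/-- The sum of the entries of the matrix `A v` in the row with label `s`. -/
def rowWeight (A : X → Matrix (Fin n) (Fin n) K) (e : G × X) : K :=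
  ∑ i, if g i = e.1 then ∑ j, A e.2 i j else 0

variable {g} in
theorem exists_of_rowWeight_ne_zero {A : X → Matrix (Fin n) (Fin n) K} {e : G × X}
    (h : rowWeight g A e ≠ 0) : ∃ i j, g i = e.1 ∧ A e.2 i j ≠ 0 := by
  obtain ⟨i, -, hi⟩ := Finset.exists_ne_zero_of_sum_ne_zero h
  have h1 : g i = e.1 := by by_contra h1; exact hi (if_neg h1)
  rw [if_pos h1] at hi
  obtain ⟨j, -, hj⟩ := Finset.exists_ne_zero_of_sum_ne_zero hi
  exact ⟨i, j, h1, hj⟩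

variable [Group G]

open scoped Classical in
/-- The matrix whose entry at `(i, j)` is the weight of the edge labelled `v` from `g i` to
`g j`, if there is such an edge. -/
def weightMatrix (θ : G × X → K) (v : X) : Matrix (Fin n) (Fin n) K :=
  Matrix.of fun i j => if g i * δ v = g j then θ (g i, v) else 0

variable {g δ}

open scoped Classical in
-- Each row of a weight matrix has at most one nonzero entry because `g` is injective, so the sum
-- over intermediate indices collapses to a single walk. By `hθ`, a step that leaves the range of
-- `g` has weight zero.
theorem prod_weightMatrix (hg : Function.Injective g) {θ : G × X → K}
    (hθ : ∀ i v, θ (g i, v) ≠ 0 → ∃ j, g j = g i * δ v) (l : List X) (i j : Fin n) :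
    (l.map (weightMatrix g δ θ)).prod i j =
      if g i * listDeg δ l = g j then walkWeight δ θ (g i) l else 0 := by
  induction l generalizing i with
  | nil => simp [Matrix.one_apply, hg.eq_iff]
  | cons v l ih =>
    rw [List.map_cons, List.prod_cons, Matrix.mul_apply]
    by_cases h : ∃ k, g k = g i * δ v
    · obtain ⟨k, hk⟩ := h
      rw [Finset.sum_eq_single k, ih]
      · simp [weightMatrix, hk, mul_assoc]
      · intro k' _ hk'
        have : g i * δ v ≠ g k' := fun h => hk' (hg (h.symm.trans hk.symm))
        simp [weightMatrix, this]
      · simp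
    · have h0 : θ (g i, v) = 0 := by
        by_contra h0; exact h (hθ i v h0)
      simp [weightMatrix, h0]

/-- A row of a homogeneous matrix has at most one nonzero entry, which is then its row sum; so every
homogeneous substitution comes from a weight. -/
theorem eq_weightMatrix_rowWeight (hg : Function.Injective g) {A : X → Matrix (Fin n) (Fin n) K}
    (hA : ∀ v i j, A v i j ≠ 0 → g i * δ v = g j) : A = weightMatrix g δ (rowWeight g A) := by
  classical
  ext v i j
  simp only [weightMatrix, rowWeight, Matrix.of_apply, hg.eq_iff, Finset.sum_ite_eq',
    Finset.mem_univ, if_true]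
  split_ifs with h
  · refine (Finset.sum_eq_single j (fun k _ hk => ?_) (by simp)).symm
    by_contra h0
    exact hk (hg ((hA v i k h0).symm.trans h))
  · by_contra h0
    exact h (hA v i j h0)

theorem isWalk_of_walkWeight_ne_zero {E : G → G → Prop} {θ : G × X → K}
    (hθ : ∀ e, θ e ≠ 0 → E e.1 (e.1 * δ e.2)) {s : G} {l : List X}
    (h : walkWeight δ θ s l ≠ 0) : IsWalk E s (l.map δ) := by
  rw [isWalk_map_iff]
  intro e he
  refine hθ e fun h0 => h (List.prod_eq_zero ?_)
  exact List.mem_map.2 ⟨e, he, h0⟩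

end WeightMatrices

/-! ### Algebras generated by matrix units -/

section MatrixUnits

variable {F : Type*} [Field F] {G : Type*} [Group G] {n : ℕ}
  (B : NonUnitalSubalgebra F (Matrix (Fin n) (Fin n) F)) (g : Fin n → G)

/-- The algebra `B` is spanned by the matrix units which it contains. -/
def IsUnitSpanned : Prop :=
  ∀ M ∈ B, ∀ i j, M i j ≠ 0 → Matrix.single i j (1 : F) ∈ B

theorem isUnitSpanned_matrixUnitAlgebra (S : Set (Fin n × Fin n)) :
    IsUnitSpanned (matrixUnitAlgebra F S) := by
  intro M hM
  induction hM using NonUnitalAlgebra.adjoin_induction with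
  | mem M hM =>
    intro i j h
    obtain ⟨p, hp, rfl⟩ := hM
    have : p.1 = i ∧ p.2 = j := by
      by_contra h0; exact h (by simp [h0])
    exact NonUnitalAlgebra.subset_adjoin F ⟨p, hp, by rw [this.1, this.2]⟩
  | add M N _ _ hM hN =>
    intro i j h
    by_cases h0 : M i j = 0
    · exact hN i j fun h1 => h (by simp [h0, h1])
    · exact hM i j h0
  | zero => simp
  | mul M N _ _ hM hN =>
    intro i j h
    rw [Matrix.mul_apply] at h
    obtain ⟨k, -, hk⟩ := Finset.exists_ne_zero_of_sum_ne_zero h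
    have := mul_mem (hM i k (left_ne_zero_of_mul hk)) (hN k j (right_ne_zero_of_mul hk))
    simpa using this
  | smul c M _ hM => exact fun i j h => hM i j fun h0 => h (by simp [h0])

/-- The relation on `G` whose edges are the pairs `(g i, g j)` with `e_ij ∈ B`. -/
def UnitEdge (s t : G) : Prop := ∃ i j, g i = s ∧ g j = t ∧ Matrix.single i j (1 : F) ∈ B

variable {B g}

theorem mem_elementaryComponent_iff {h : G} {M : Matrix (Fin n) (Fin n) F} :
    M ∈ elementaryComponent F g h ↔ ∀ i j, M i j ≠ 0 → g i * h = g j := by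
  constructor
  · intro hM
    induction hM using Submodule.span_induction with
    | mem M hM =>
      obtain ⟨i, j, rfl, rfl⟩ := hM
      intro i' j' h
      have : i = i' ∧ j = j' := by
        by_contra h0; exact h (by simp [h0])
      rw [← this.1, ← this.2, mul_inv_cancel_left]
    | zero => simp
    | add M N _ _ hM hN =>
      intro i j h
      by_cases h0 : M i j = 0
      · exact hN i j fun h1 => h (by simp [h0, h1])
      · exact hM i j h0
    | smul c M _ hM => exact fun i j h => hM i j fun h0 => h (by simp [h0])
  · intro hM
    rw [Matrix.matrix_eq_sum_single M]
    refine Submodule.sum_mem _ fun i _ => Submodule.sum_mem _ fun j _ => ?_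
    by_cases h0 : M i j = 0
    · simp [h0]
    · rw [← mul_one (M i j), ← smul_eq_mul, ← Matrix.smul_single]
      exact Submodule.smul_mem _ _ (Submodule.subset_span ⟨i, j, by
        rw [← hM i j h0, inv_mul_cancel_left], rfl⟩)

theorem mem_inducedComponent_iff {h : G} {M : B} :
    M ∈ inducedComponent B g h ↔ ∀ i j, M.1 i j ≠ 0 → g i * h = g j :=
  mem_elementaryComponent_iff

theorem single_mem_inducedComponent {i j : Fin n} (hij : Matrix.single i j (1 : F) ∈ B) {h : G}
    (h' : g i * h = g j) : (⟨_, hij⟩ : B) ∈ inducedComponent B g h := by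
  rw [mem_inducedComponent_iff]
  intro i' j' h0
  have : i = i' ∧ j = j' := by
    by_contra h1; exact h0 (by simp [h1])
  rwa [← this.1, ← this.2]

theorem mem_gradingSupport_iff (hB : IsUnitSpanned B) {h : G} :
    h ∈ gradingSupport B g ↔ ∃ s, UnitEdge B g s (s * h) := by
  constructor
  · intro hh
    obtain ⟨M, hM, hM0⟩ := Submodule.exists_mem_ne_zero_of_ne_bot hh
    have : ∃ i j, M.1 i j ≠ 0 := by
      by_contra! h0; exact hM0 (Subtype.ext (Matrix.ext h0))
    obtain ⟨i, j, hij⟩ := this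
    exact ⟨g i, i, j, rfl, (mem_inducedComponent_iff.1 hM i j hij).symm, hB _ M.2 i j hij⟩
  · rintro ⟨_, i, j, rfl, hj, hij⟩ h0
    have h1 := single_mem_inducedComponent hij hj.symm
    rw [h0, Submodule.mem_bot] at h1
    have := congrFun (congrFun (congrArg Subtype.val h1) i) j
    simp at this

theorem exists_end_of_isWalk {X : Type*} {δ : X → G} {l : List X} (hl : l ≠ []) {s : G}
    (hw : IsWalk (UnitEdge B g) s (l.map δ)) : ∃ j, g j = s * listDeg δ l := by
  induction l generalizing s with
  | nil => exact absurd rfl hl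
  | cons v l ih =>
    obtain ⟨⟨_, j, -, hj, -⟩, hw⟩ := hw
    by_cases hl' : l = []
    · exact ⟨j, by simp [hj, hl']⟩
    · obtain ⟨k, hk⟩ := ih hl' hw
      exact ⟨k, by rw [hk, listDeg_cons, mul_assoc]⟩

theorem finite_gradingSupport (hB : IsUnitSpanned B) : (gradingSupport B g).Finite := by
  refine (Set.finite_range fun p : Fin n × Fin n => (g p.1)⁻¹ * g p.2).subset ?_
  intro h hh
  obtain ⟨_, i, j, rfl, hj, -⟩ := (mem_gradingSupport_iff hB).1 hh
  exact ⟨(i, j), by simp [hj]⟩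

/-- Weight `1` on every edge of `B` gives the entry `1` along any walk in `B`. Conversely, every
homogeneous substitution is given by a weight supported on these edges. -/
theorem listWord_mem_gradedIdentities_iff (hB : IsUnitSpanned B) (hg : Function.Injective g)
    {l : List (G × ℕ)} (hl : l ≠ []) :
    listWord F l ∈ gradedIdentities (inducedComponent B g) ↔
      ∀ i, ¬ IsWalk (UnitEdge B g) (g i) (l.map Prod.fst) := by
  classical
  have hmap : ∀ (a : G × ℕ → B),
      (evalAt a (listWord F l) : Matrix (Fin n) (Fin n) F) = (l.map fun v => (a v).1).prod :=
    fun a => (map_evalAt a (NonUnitalSubalgebraClass.subtype B) _).trans (evalAt_listWord _ hl)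
  constructor
  · intro h i hw
    let θ : G × G × ℕ → F := fun e => if UnitEdge B g e.1 (e.1 * e.2.1) then 1 else 0
    have hθ : ∀ e, θ e ≠ 0 → UnitEdge B g e.1 (e.1 * e.2.1) := fun e he => by
      by_contra h0; exact he (if_neg h0)
    have hentry : ∀ v i j, weightMatrix g Prod.fst θ v i j ≠ 0 →
        g i * v.1 = g j ∧ Matrix.single i j (1 : F) ∈ B := by
      intro v i j h0
      have h1 : g i * v.1 = g j := by by_contra h1; exact h0 (if_neg h1)
      have h2 : θ (g i, v) ≠ 0 := by
        intro h2; exact h0 (by simp [weightMatrix, h2])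
      obtain ⟨i', j', hi, hj, hij⟩ := hθ _ h2
      rw [hg hi, hg (hj.trans h1)] at hij
      exact ⟨h1, hij⟩
    have hmem : ∀ v, weightMatrix g Prod.fst θ v ∈ B := by
      intro v
      rw [Matrix.matrix_eq_sum_single (weightMatrix g Prod.fst θ v)]
      refine sum_mem fun i _ => sum_mem fun j _ => ?_
      by_cases h0 : weightMatrix g Prod.fst θ v i j = 0
      · rw [h0, Matrix.single_zero]; exact zero_mem _
      · rw [← mul_one (weightMatrix g Prod.fst θ v i j), ← smul_eq_mul, ← Matrix.smul_single]
        exact SMulMemClass.smul_mem _ (hentry v i j h0).2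
    have h1 := h (fun v => ⟨_, hmem v⟩) fun v =>
      mem_inducedComponent_iff.2 fun i j h0 => (hentry v i j h0).1
    have h2 := hmap fun v => ⟨_, hmem v⟩
    rw [h1] at h2
    have hw1 : walkWeight Prod.fst θ (g i) l = 1 := by
      rw [isWalk_map_iff] at hw
      refine List.prod_eq_one fun x hx => ?_
      obtain ⟨e, he, rfl⟩ := List.mem_map.1 hx
      exact if_pos (hw e he)
    obtain ⟨j, hj⟩ := exists_end_of_isWalk hl hw
    have h3 := congrFun (congrFun h2 i) j
    rw [prod_weightMatrix hg (fun i v h => let ⟨_, j, _, hj, _⟩ := hθ _ h; ⟨j, hj⟩),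
      if_pos hj.symm, hw1] at h3
    exact zero_ne_one h3
  · intro h a ha
    refine Subtype.ext ?_
    rw [hmap]
    have hA : ∀ v i j, (a v).1 i j ≠ 0 → g i * v.1 = g j := fun v =>
      mem_inducedComponent_iff.1 (ha v)
    have hθ : ∀ e, rowWeight g (fun v => (a v).1) e ≠ 0 → UnitEdge B g e.1 (e.1 * e.2.1) := by
      intro e he
      obtain ⟨i, j, hi, hij⟩ := exists_of_rowWeight_ne_zero he
      exact ⟨i, j, hi, by rw [← hA _ i j hij, hi], hB _ (a e.2).2 i j hij⟩
    rw [eq_weightMatrix_rowWeight hg hA]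
    ext i j
    rw [prod_weightMatrix hg fun i v h => let ⟨_, j, _, hj, _⟩ := hθ _ h; ⟨j, hj⟩]
    split_ifs
    · by_contra h0
      exact h i (isWalk_of_walkWeight_ne_zero hθ h0)
    · rfl

end MatrixUnits

/-! ### The tensor product as an algebra of matrices -/

section TensorMatrix

variable {F : Type*} [Field F] {n : ℕ} (B : NonUnitalSubalgebra F (Matrix (Fin n) (Fin n) F))
  (K : Type*) [Ring K] [Algebra F K]

/-- The linear map `B ⊗ K → M_n(K)` which sends `b ⊗ k` to the matrix with entries `b_ij k`. -/
def tensorMatrixLinear : B ⊗[F] K →ₗ[F] Matrix (Fin n) (Fin n) K :=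
  TensorProduct.lift (LinearMap.mk₂ F (fun b k => Matrix.of fun i j => b.1 i j • k)
    (fun b b' k => by ext i j; simp [add_smul]) (fun c b k => by ext i j; simp [mul_smul])
    (fun b k k' => by ext i j; simp) (fun c b k => by ext i j; simp [smul_comm c]))

variable {B K} in
theorem tensorMatrixLinear_tmul (b : B) (k : K) (i j : Fin n) :
    tensorMatrixLinear B K (b ⊗ₜ k) i j = b.1 i j • k := rfl

/-- The homomorphism `B ⊗ K → M_n(K)` which sends `b ⊗ k` to the matrix with entries
`b_ij k`. -/
def tensorMatrix : B ⊗[F] K →ₙₐ[F] Matrix (Fin n) (Fin n) K :=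
  { tensorMatrixLinear B K with
    map_smul' := (tensorMatrixLinear B K).map_smul
    map_zero' := (tensorMatrixLinear B K).map_zero
    map_mul' := fun x y => by
      change tensorMatrixLinear B K (x * y) =
        tensorMatrixLinear B K x * tensorMatrixLinear B K y
      induction x using TensorProduct.induction_on with
      | zero => simp
      | add x x' hx hx' => rw [add_mul, map_add, map_add, hx, hx', add_mul]
      | tmul b k =>
        induction y using TensorProduct.induction_on with
        | zero => simp
        | add y y' hy hy' => rw [mul_add, map_add, map_add, hy, hy', mul_add]
        | tmul b' k' =>
          ext i j
          simp only [Algebra.TensorProduct.tmul_mul_tmul, tensorMatrixLinear_tmul, Matrix.mul_apply,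
            NonUnitalSubalgebra.coe_mul, Finset.sum_smul, smul_mul_smul_comm] }

variable {B K}

theorem tensorMatrix_tmul (b : B) (k : K) (i j : Fin n) :
    tensorMatrix B K (b ⊗ₜ k) i j = b.1 i j • k := rfl

variable (B K) in
open scoped Classical in
/-- The linear map `M_n(K) → B ⊗ K` which sends a matrix to the sum of `e_ij ⊗ X_ij` over the
matrix units in `B`. -/
def matrixTensor : Matrix (Fin n) (Fin n) K →ₗ[F] B ⊗[F] K :=
  ∑ i, ∑ j, if h : Matrix.single i j (1 : F) ∈ B then
    (TensorProduct.mk F B K ⟨_, h⟩).comp (Matrix.entryLinearMap F K i j) else 0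

open scoped Classical in
theorem matrixTensor_apply (X : Matrix (Fin n) (Fin n) K) :
    matrixTensor B K X = ∑ i, ∑ j, if h : Matrix.single i j (1 : F) ∈ B then
      (⟨_, h⟩ : B) ⊗ₜ[F] X i j else 0 := by
  simp only [matrixTensor, LinearMap.sum_apply]
  refine Finset.sum_congr rfl fun i _ => Finset.sum_congr rfl fun j _ => ?_
  split_ifs <;> rfl

/-- Expanding the left factor in the matrix units of `B` recovers the tensor from its entries, so
identities can be tested in `M_n(K)`. -/
theorem matrixTensor_tensorMatrix (hB : IsUnitSpanned B) (x : B ⊗[F] K) :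
    matrixTensor B K (tensorMatrix B K x) = x := by
  classical
  induction x using TensorProduct.induction_on with
  | zero => simp
  | add x y hx hy => rw [map_add, map_add, hx, hy]
  | tmul b k =>
    have hb : b = ∑ i, ∑ j, if h : Matrix.single i j (1 : F) ∈ B then
        b.1 i j • (⟨_, h⟩ : B) else 0 := by
      refine Subtype.ext ?_
      conv_lhs => rw [Matrix.matrix_eq_sum_single b.1]
      simp only [AddSubmonoidClass.coe_finsetSum]
      refine Finset.sum_congr rfl fun i _ => Finset.sum_congr rfl fun j _ => ?_
      split_ifs with h
      · simp
      · have : b.1 i j = 0 := by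
          by_contra h0; exact h (hB _ b.2 i j h0)
        simp [this]
    conv_rhs => rw [hb]
    rw [matrixTensor_apply]
    simp only [TensorProduct.sum_tmul]
    refine Finset.sum_congr rfl fun i _ => Finset.sum_congr rfl fun j _ => ?_
    split_ifs
    · rw [tensorMatrix_tmul, TensorProduct.tmul_smul, TensorProduct.smul_tmul']
    · simp

theorem tensorMatrix_injective (hB : IsUnitSpanned B) :
    Function.Injective (tensorMatrix B K) :=
  (show Function.LeftInverse (matrixTensor B K) (tensorMatrix B K) from
    matrixTensor_tensorMatrix hB).injective

theorem tensorMatrix_matrixTensor {X : Matrix (Fin n) (Fin n) K}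
    (hX : ∀ i j, X i j ≠ 0 → Matrix.single i j (1 : F) ∈ B) :
    tensorMatrix B K (matrixTensor B K X) = X := by
  classical
  rw [matrixTensor_apply]
  ext i j
  simp only [map_sum, Matrix.sum_apply]
  rw [Finset.sum_eq_single i, Finset.sum_eq_single j]
  · split_ifs with h
    · simp [tensorMatrix_tmul]
    · rw [map_zero, Matrix.zero_apply]
      by_contra h0
      exact h (hX i j (Ne.symm h0))
  · intro j' _ hj
    split_ifs with h
    · simp [tensorMatrix_tmul, hj]
    · simp
  · simp
  · intro i' _ hi
    refine Finset.sum_eq_zero fun j' _ => ?_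
    split_ifs with h
    · simp [tensorMatrix_tmul, hi]
    · simp
  · simp

end TensorMatrix

/-! ### Graded identities of the tensor product in terms of weights -/

section TensorIdentities

variable {F V : Type*} [Field F] [AddCommGroup V] [Module F V] {G : Type*} [Group G] {n : ℕ}
  {B : NonUnitalSubalgebra F (Matrix (Fin n) (Fin n) F)} {g : Fin n → G}

theorem tensorMatrix_apply_of_mem (hB : IsUnitSpanned B) {d : SuperDeg G}
    {x : B ⊗[F] ExteriorAlgebra F V}
    (hx : x ∈ tensorComponent (inducedComponent B g) (grassmannComponent F V) d) (i j : Fin n) :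
    tensorMatrix B _ x i j ∈ grassmannComponent F V d.2.toAdd ∧
      (tensorMatrix B _ x i j ≠ 0 → g i * d.1 = g j ∧ Matrix.single i j (1 : F) ∈ B) := by
  -- For fixed `i` and `j` the claim cuts out a subspace, so it need only be checked on pure
  -- tensors.
  let P : Submodule F (B ⊗[F] ExteriorAlgebra F V) :=
    { carrier := {x | tensorMatrix B _ x i j ∈ grassmannComponent F V d.2.toAdd ∧
        (tensorMatrix B _ x i j ≠ 0 → g i * d.1 = g j ∧ Matrix.single i j (1 : F) ∈ B)}
      zero_mem' := ⟨by rw [map_zero]; exact Submodule.zero_mem _, fun h => absurd (by simp) h⟩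
      add_mem' := fun {x y} hx hy => by
        refine ⟨by rw [map_add]; exact Submodule.add_mem _ hx.1 hy.1, fun h => ?_⟩
        by_cases h0 : tensorMatrix B _ x i j = 0
        · exact hy.2 fun h1 => h (by simp [h0, h1])
        · exact hx.2 h0
      smul_mem' := fun c x hx => by
        refine ⟨by rw [map_smul]; exact Submodule.smul_mem _ _ hx.1, fun h => ?_⟩
        exact hx.2 fun h1 => h (by simp [h1]) }
  suffices H : tensorComponent (inducedComponent B g) (grassmannComponent F V) d ≤ P from H hx
  refine Submodule.map₂_le.2 fun b hb u hu => ⟨Submodule.smul_mem _ _ hu, fun h => ?_⟩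
  have h0 : b.1 i j ≠ 0 := fun h0 => h (by
    rw [TensorProduct.mk_apply, tensorMatrix_tmul, h0, zero_smul])
  exact ⟨mem_inducedComponent_iff.1 hb i j h0, hB _ b.2 i j h0⟩

theorem matrixTensor_mem {d : SuperDeg G} {X : Matrix (Fin n) (Fin n) (ExteriorAlgebra F V)}
    (hX : ∀ i j, X i j ∈ grassmannComponent F V d.2.toAdd)
    (hX' : ∀ i j, X i j ≠ 0 → g i * d.1 = g j) :
    matrixTensor B _ X ∈ tensorComponent (inducedComponent B g) (grassmannComponent F V) d := by
  classical
  rw [matrixTensor_apply]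
  refine Submodule.sum_mem _ fun i _ => Submodule.sum_mem _ fun j _ => ?_
  split_ifs with h
  · by_cases h0 : X i j = 0
    · rw [h0, TensorProduct.tmul_zero]; exact Submodule.zero_mem _
    · exact Submodule.apply_mem_map₂ _ (single_mem_inducedComponent h (hX' i j h0)) (hX i j)
  · exact Submodule.zero_mem _

theorem tensorComponent_mul_mem (hB : IsUnitSpanned B) {d d' : SuperDeg G}
    {x y : B ⊗[F] ExteriorAlgebra F V}
    (hx : x ∈ tensorComponent (inducedComponent B g) (grassmannComponent F V) d)
    (hy : y ∈ tensorComponent (inducedComponent B g) (grassmannComponent F V) d') :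
    x * y ∈ tensorComponent (inducedComponent B g) (grassmannComponent F V) (d * d') := by
  have hx' := tensorMatrix_apply_of_mem hB hx
  have hy' := tensorMatrix_apply_of_mem hB hy
  rw [← matrixTensor_tensorMatrix hB (x * y)]
  refine matrixTensor_mem (fun i j => ?_) fun i j h => ?_
  · rw [map_mul, Matrix.mul_apply]
    exact Submodule.sum_mem _ fun k _ => mul_mem_grassmannComponent (hx' i k).1 (hy' k j).1
  · rw [map_mul, Matrix.mul_apply] at h
    obtain ⟨k, -, hk⟩ := Finset.exists_ne_zero_of_sum_ne_zero h
    rw [Prod.fst_mul, ← mul_assoc, ((hx' i k).2 (left_ne_zero_of_mul hk)).1,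
      ((hy' k j).2 (right_ne_zero_of_mul hk)).1]

/-- A parity-preserving weight which is supported on the edges of `B`. -/
def IsAdmissibleWeight (B : NonUnitalSubalgebra F (Matrix (Fin n) (Fin n) F)) (g : Fin n → G)
    (θ : G × SuperDeg G × ℕ → ExteriorAlgebra F V) : Prop :=
  IsGradedWeight θ ∧ ∀ e, θ e ≠ 0 → UnitEdge B g e.1 (e.1 * varDeg e.2)

/-- An admissible weight gives a homogeneous substitution through `matrixTensor`; the row sums of
the image of a homogeneous substitution under `tensorMatrix` give an admissible weight. -/
theorem mem_gradedIdentities_iff (hB : IsUnitSpanned B) (hg : Function.Injective g)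
    {f : FreeGraded F (SuperDeg G)} :
    f ∈ gradedIdentities (A := B ⊗[F] ExteriorAlgebra F V)
        (tensorComponent (inducedComponent B g) (grassmannComponent F V)) ↔
      ∀ θ : G × SuperDeg G × ℕ → ExteriorAlgebra F V, IsAdmissibleWeight B g θ →
        evalAt (weightMatrix g varDeg θ) f = 0 := by
  constructor
  · intro hf θ hθ
    have hne : ∀ v i j, weightMatrix g varDeg θ v i j ≠ 0 →
        g i * varDeg v = g j ∧ Matrix.single i j (1 : F) ∈ B := by
      classical
      intro v i j h0
      have h1 : g i * varDeg v = g j := by by_contra h1; exact h0 (if_neg h1)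
      have h2 : θ (g i, v) ≠ 0 := by
        intro h2; exact h0 (by simp [weightMatrix, h2])
      obtain ⟨i', j', hi, hj, hij⟩ := hθ.2 _ h2
      rw [hg hi, hg (hj.trans h1)] at hij
      exact ⟨h1, hij⟩
    have h1 := hf (fun v => matrixTensor B _ (weightMatrix g varDeg θ v)) fun v =>
      matrixTensor_mem (fun i j => by
        classical
        simp only [weightMatrix, Matrix.of_apply]
        split_ifs
        · exact hθ.1 (g i, v)
        · exact Submodule.zero_mem _) fun i j h => (hne v i j h).1
    have h2 := map_evalAt (fun v => matrixTensor B _ (weightMatrix g varDeg θ v))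
      (tensorMatrix B (ExteriorAlgebra F V)) f
    rw [h1, map_zero] at h2
    rw [h2]
    congr 2
    ext1 v
    exact (tensorMatrix_matrixTensor fun i j h => (hne v i j h).2).symm
  · intro h a ha
    refine tensorMatrix_injective hB ?_
    rw [map_zero]
    refine (map_evalAt a (tensorMatrix B _) f).trans ?_
    have hA := fun v => tensorMatrix_apply_of_mem hB (ha v)
    rw [eq_weightMatrix_rowWeight (δ := varDeg) hg fun v i j hij => ((hA v i j).2 hij).1]
    refine h _ ⟨fun e => Submodule.sum_mem _ fun i _ => ?_, fun e he => ?_⟩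
    · split_ifs
      · exact Submodule.sum_mem _ fun j _ => (hA e.2 i j).1
      · exact Submodule.zero_mem _
    · obtain ⟨i, j, hi, hij⟩ := exists_of_rowWeight_ne_zero he
      have := (hA e.2 i j).2 hij
      exact ⟨i, j, hi, by rw [← this.1, hi]; rfl, this.2⟩

end TensorIdentities

/-! ### The basis consists of identities -/

section Soundness

variable {F V : Type*} [Field F] [AddCommGroup V] [Module F V] {G : Type*} [Group G] {n : ℕ}
  {B : NonUnitalSubalgebra F (Matrix (Fin n) (Fin n) F)} {g : Fin n → G}

theorem IsAdmissibleWeight.exists_eq_mul {θ : G × SuperDeg G × ℕ → ExteriorAlgebra F V}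
    (hθ : IsAdmissibleWeight B g θ) (i : Fin n) (v : SuperDeg G × ℕ) (h : θ (g i, v) ≠ 0) :
    ∃ j, g j = g i * varDeg v :=
  let ⟨_, j, _, hj, _⟩ := hθ.2 _ h
  ⟨j, hj⟩

open scoped Classical in
theorem evalAt_weightMatrix_listWord (hg : Function.Injective g)
    {θ : G × SuperDeg G × ℕ → ExteriorAlgebra F V} (hθ : IsAdmissibleWeight B g θ)
    {l : List (SuperDeg G × ℕ)} (hl : l ≠ []) (i j : Fin n) :
    evalAt (weightMatrix g varDeg θ) (listWord F l) i j =
      if g i * listDeg varDeg l = g j then walkWeight varDeg θ (g i) l else 0 := by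
  rw [evalAt_listWord _ hl, prod_weightMatrix hg hθ.exists_eq_mul]

variable (V) in
theorem reverse_mem_gradedIdentities (hB : IsUnitSpanned B) (hg : Function.Injective g)
    (u t v : List (SuperDeg G × ℕ)) (hu : u ≠ []) (hv : v ≠ [])
    (huv : listDeg varDeg u = listDeg varDeg v)
    (hut : listDeg varDeg u * listDeg varDeg t = 1) :
    listWord F (u ++ t ++ v) - reversalSign F (listParity u) (listParity t) (listParity v) •
      listWord F (v ++ t ++ u) ∈ gradedIdentities (A := B ⊗[F] ExteriorAlgebra F V)
        (tensorComponent (inducedComponent B g) (grassmannComponent F V)) := by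
  rw [mem_gradedIdentities_iff hB hg]
  intro θ hθ
  ext i j
  have h := hθ.1.walkWeight_reverse (g i) [] huv hut
  simp only [List.append_nil] at h
  rw [map_sub, map_smul, Matrix.sub_apply, Matrix.smul_apply,
    evalAt_weightMatrix_listWord hg hθ (by simp [hu]),
    evalAt_weightMatrix_listWord hg hθ (by simp [hv]), h,
    show listDeg varDeg (u ++ t ++ v) = listDeg varDeg (v ++ t ++ u) by simp [huv]]
  split_ifs <;> simp

variable (V) in
theorem listWord_mem_gradedIdentities_of_not_isWalk (hB : IsUnitSpanned B)
    (hg : Function.Injective g) {l : List (SuperDeg G × ℕ)}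
    (h : ∀ i, ¬ IsWalk (UnitEdge B g) (g i) (l.map varDeg)) :
    listWord F l ∈ gradedIdentities (A := B ⊗[F] ExteriorAlgebra F V)
      (tensorComponent (inducedComponent B g) (grassmannComponent F V)) := by
  by_cases hl : l = []
  · subst hl; exact Submodule.zero_mem _
  rw [mem_gradedIdentities_iff hB hg]
  intro θ hθ
  ext i j
  rw [evalAt_weightMatrix_listWord hg hθ hl]
  split_ifs
  · by_contra h0
    exact h i (isWalk_of_walkWeight_ne_zero hθ.2 h0)
  · rfl

theorem superizedPolynomial_mem_gradedIdentities (hB : IsUnitSpanned B)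
    (hg : Function.Injective g) {f : FreeGraded F (SuperDeg G)}
    (hf : SuperizedPolynomial F (gradingSupport B g) f) :
    f ∈ gradedIdentities (A := B ⊗[F] ExteriorAlgebra F V)
      (tensorComponent (inducedComponent B g) (grassmannComponent F V)) := by
  have key : ∀ (h : G) (a c b : ZMod 2),
      listWord F [((h, Multiplicative.ofAdd a), 1), ((h⁻¹, Multiplicative.ofAdd c), 2),
        ((h, Multiplicative.ofAdd b), 3)] - reversalSign F a c b •
      listWord F [((h, Multiplicative.ofAdd b), 3), ((h⁻¹, Multiplicative.ofAdd c), 2),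
        ((h, Multiplicative.ofAdd a), 1)] ∈
      gradedIdentities (A := B ⊗[F] ExteriorAlgebra F V)
        (tensorComponent (inducedComponent B g) (grassmannComponent F V)) := fun h a c b => by
    simpa [varParity] using reverse_mem_gradedIdentities V hB hg
      [((h, Multiplicative.ofAdd a), 1)] [((h⁻¹, Multiplicative.ofAdd c), 2)]
      [((h, Multiplicative.ofAdd b), 3)] (by simp) (by simp) (by simp [varDeg]) (by simp [varDeg])
  -- Commutation in degree `1` is reversal around an empty middle factor.
  have key' : ∀ (a b : ZMod 2),
      listWord F [(((1 : G), Multiplicative.ofAdd a), 1), ((1, Multiplicative.ofAdd b), 2)] -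
        koszulSign F a b •
      listWord F [((1, Multiplicative.ofAdd b), 2), ((1, Multiplicative.ofAdd a), 1)] ∈
      gradedIdentities (A := B ⊗[F] ExteriorAlgebra F V)
        (tensorComponent (inducedComponent B g) (grassmannComponent F V)) := fun a b => by
    simpa [varParity, reversalSign] using reverse_mem_gradedIdentities V hB hg
      [((1, Multiplicative.ofAdd a), 1)] [] [((1, Multiplicative.ofAdd b), 2)]
      (by simp) (by simp) (by simp [varDeg]) (by simp [varDeg])
  cases hf with
  | comm_xz he δ => simpa [xvar, zvar, gvar_mul_gvar] using key' 0 δ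
  | comm_yy he => simpa [yvar, zvar, gvar_mul_gvar] using key' 1 1
  | zxx h hne hh δ =>
    simpa [xvar, zvar, gvar_mul_gvar_mul_gvar, reversalSign] using key h δ 0 0
  | xyx h hne hh =>
    simpa [xvar, yvar, zvar, gvar_mul_gvar_mul_gvar, reversalSign] using key h 0 1 0
  | yyx h hne hh =>
    simpa [xvar, yvar, zvar, gvar_mul_gvar_mul_gvar, reversalSign] using key h 1 1 0
  | yxy h hne hh =>
    simpa [xvar, yvar, zvar, gvar_mul_gvar_mul_gvar, reversalSign] using key h 1 0 1
  | yyy h hne hh =>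
    simpa [xvar, yvar, zvar, gvar_mul_gvar_mul_gvar, reversalSign] using key h 1 1 1
  | single h hh δ =>
    rw [zvar, gvar_eq_listWord]
    refine listWord_mem_gradedIdentities_of_not_isWalk V hB hg fun i hi => hh ?_
    exact (mem_gradingSupport_iff hB).2 ⟨g i, hi.1⟩

theorem superMonomials_subset_gradedIdentities (hB : IsUnitSpanned B)
    (hg : Function.Injective g) :
    superMonomials B g ⊆ gradedIdentities (A := B ⊗[F] ExteriorAlgebra F V)
      (tensorComponent (inducedComponent B g) (grassmannComponent F V)) := by
  rintro f ⟨q, h, δ, -, -, -, hid, rfl⟩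
  rw [multilinearMonomial_eq_listWord] at hid ⊢
  rw [listWord_mem_gradedIdentities_iff hB hg (by simp)] at hid
  refine listWord_mem_gradedIdentities_of_not_isWalk V hB hg fun i hi => hid i ?_
  simpa [List.map_ofFn, Function.comp_def, varDeg] using hi

theorem finite_superMonomials (hB : IsUnitSpanned B) : (superMonomials B g).Finite := by
  have hG := finite_gradingSupport (g := g) hB
  have : (⋃ q ∈ Set.Iio (2 * n), (fun p : (Fin (q + 1) → G) × (Fin (q + 1) → ZMod 2) =>
      multilinearMonomial F fun k => ((p.1 k, Multiplicative.ofAdd (p.2 k)) : SuperDeg G)) ''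
      ((Set.univ.pi fun _ => gradingSupport B g) ×ˢ Set.univ)).Finite :=
    (Set.finite_Iio _).biUnion fun q _ =>
      ((Set.Finite.pi fun _ => hG).prod Set.finite_univ).image _
  refine this.subset ?_
  rintro f ⟨q, h, δ, h2, hq, hG, -, rfl⟩
  simp only [Set.mem_iUnion]
  exact ⟨q, by simp only [Set.mem_Iio]; omega, (h, δ), ⟨fun k _ => hG k, trivial⟩, rfl⟩

end Soundness

/-! ### Words which vanish on `B` -/

section Vanishing

variable {F : Type*} [Field F] {G : Type*} [Group G] {n : ℕ}
  {B : NonUnitalSubalgebra F (Matrix (Fin n) (Fin n) F)} {g : Fin n → G}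
  {I : Submodule F (FreeGraded F (SuperDeg G))}

theorem ofFn_getD {Y Z : Type*} (c : List Y) (a : Y) (φ : Y → Z) {m : ℕ} (hm : c.length = m) :
    List.ofFn (fun k : Fin m => φ (c.getD k a)) = c.map φ := by
  subst hm
  exact List.ext_getElem (by simp) (by simp)

/-- A word which vanishes on `B` lies in every `T`-ideal that contains the short ones. -/
theorem listWord_mem_of_not_isWalk (hB : IsUnitSpanned B) (hg : Function.Injective g)
    (hI : IsTIdeal I) (hS : ∀ f, SuperizedPolynomial F (gradingSupport B g) f → f ∈ I)
    (hM : superMonomials B g ⊆ I) {l : List (SuperDeg G × ℕ)} (hl : l ≠ [])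
    (h : ∀ i, ¬ IsWalk (UnitEdge B g) (g i) (l.map varDeg)) : listWord F l ∈ I := by
  classical
  rcases Nat.eq_zero_or_pos n with rfl | hn
  -- For `n = 0` there are no edges and the support is empty, so the listed variables already
  -- generate everything.
  · refine listWord_mem_of_degree_not_mem hI hS hl fun hG => ?_
    obtain ⟨_, i, _⟩ := (mem_gradingSupport_iff hB).1 hG
    exact i.elim0
  obtain ⟨u, c, r, rfl, hc, hb, hw⟩ := exists_coarsening (δ := varDeg) (UnitEdge B g)
    (Finset.univ.image g) ⟨g ⟨0, hn⟩, by simp⟩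
    (fun s t ⟨_, j, _, hj, _⟩ => by simp [← hj]) l (by simpa using h)
  replace hw : ∀ i, ¬ IsWalk (UnitEdge B g) (g i) (c.map (listDeg varDeg)) := by
    simpa using hw
  rw [Finset.card_image_of_injective _ hg, Finset.card_fin] at hc
  have hc0 : c ≠ [] := by rintro rfl; exact hw ⟨0, hn⟩ trivial
  have hcf : c.flatten ≠ [] := by
    obtain ⟨b, c, rfl⟩ := List.exists_cons_of_ne_nil hc0
    simp [hb b]
  refine hI.listWord_context hcf ?_ u r
  by_cases hG : ∀ b ∈ c, listDeg varDeg b ∈ gradingSupport B g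
  swap
  · push Not at hG
    obtain ⟨b, hbc, hbG⟩ := hG
    obtain ⟨c₁, c₂, rfl⟩ := List.append_of_mem hbc
    simpa using hI.listWord_context (hb b hbc) (listWord_mem_of_degree_not_mem hI hS (hb b hbc) hbG)
      c₁.flatten c₂.flatten
  obtain ⟨q, hq⟩ := Nat.exists_eq_succ_of_ne_zero (mt List.length_eq_zero_iff.1 hc0)
  -- A single block with degree in the support would read a walk of length one; so there are at
  -- least two blocks, as the listed monomials require.
  have hq1 : q ≠ 0 := by
    rintro rfl
    obtain ⟨b, rfl⟩ := List.length_eq_one_iff.1 hq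
    obtain ⟨s, hs⟩ := (mem_gradingSupport_iff hB).1 (hG b (by simp))
    obtain ⟨i, _, rfl, _⟩ := id hs
    exact hw i ⟨hs, trivial⟩
  have hget : ∀ k : Fin (q + 1), c.getD k [] ∈ c := fun k => by
    rw [List.getD_eq_getElem _ _ (by omega)]; exact List.getElem_mem _
  have hmem := hM ⟨q, fun k => listDeg varDeg (c.getD k []), fun k => listParity (c.getD k []),
    by omega, by omega, fun k => hG _ (hget k), by
      rw [multilinearMonomial_eq_listWord, listWord_mem_gradedIdentities_iff hB hg (by simp),
        List.map_ofFn]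
      simp only [Function.comp_def]
      rwa [ofFn_getD c [] _ hq], rfl⟩
  -- Variables of the multilinear monomial are numbered from `1`, blocks from `0`.
  obtain ⟨φ, hφ, hφl⟩ := hI.exists_subst fun i => c.getD (i - 1) []
  have h1 := hφ _ hmem
  rw [multilinearMonomial_eq_listWord, hφl, List.map_ofFn] at h1
  · simp only [Function.comp_def, Nat.add_sub_cancel] at h1
    rwa [ofFn_getD c [] (fun b => b) hq, List.map_id'] at h1
  · intro v hv
    obtain ⟨k, rfl⟩ := List.mem_ofFn.1 hv
    exact ⟨hb _ (hget k), listDeg_fst_eq _⟩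

end Vanishing

/-! ### Generic weights -/

section Generic

/-- A polynomial that vanishes on an infinite field has zero coefficients; linear functionals reduce
vector coefficients to scalar ones. -/
theorem sum_filter_eq_zero_of_forall_prod {F σ ι E : Type*} [Field F] [Infinite F]
    [AddCommGroup E] [Module F E] (s : Finset ι) (m : ι → Multiset σ) (x : ι → E)
    (h : ∀ ξ : σ → F, ∑ i ∈ s, ((m i).map ξ).prod • x i = 0) (μ : Multiset σ)
    [DecidablePred fun i => m i = μ] : ∑ i ∈ s with m i = μ, x i = 0 := by
  classical
  rw [← Module.forall_dual_apply_eq_zero_iff F]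
  intro φ
  have hp : ∑ i ∈ s, MvPolynomial.monomial (Multiset.toFinsupp (m i)) (φ (x i)) = 0 := by
    refine MvPolynomial.funext fun ξ => ?_
    have h1 := congrArg φ (h ξ)
    rw [map_sum, map_zero] at h1
    rw [map_sum, map_zero, ← h1]
    refine Finset.sum_congr rfl fun i _ => ?_
    rw [MvPolynomial.eval_monomial, map_smul, smul_eq_mul, mul_comm,
      Finset.prod_multiset_map_count, Finsupp.prod, Multiset.toFinsupp_support]
    simp
  have h2 := congrArg (MvPolynomial.coeff (Multiset.toFinsupp μ)) hp
  rw [MvPolynomial.coeff_sum, MvPolynomial.coeff_zero] at h2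
  rw [map_sum, Finset.sum_filter]
  refine (Finset.sum_congr rfl fun i _ => ?_).trans h2
  rw [MvPolynomial.coeff_monomial]
  simp

theorem exists_linearIndependent_nat {F V : Type*} [Field F] [AddCommGroup V] [Module F V]
    (hV : ¬ FiniteDimensional F V) : ∃ b : ℕ → V, LinearIndependent F b := by
  let β := Module.Basis.ofVectorSpace F V
  have : Infinite (Module.Basis.ofVectorSpaceIndex F V) := by
    by_contra hfin
    rw [not_infinite_iff_finite] at hfin
    exact hV (Module.Finite.of_basis β)
  exact ⟨_, β.linearIndependent.comp _ (Infinite.natEmbedding _).injective⟩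

variable {F V : Type*} [Field F] [AddCommGroup V] [Module F V] {G : Type*} [Group G] {n : ℕ}
  {B : NonUnitalSubalgebra F (Matrix (Fin n) (Fin n) F)} {g : Fin n → G}

variable (B g) in
-- `G` may be uncountable, but an edge of `B` is determined by two indices in `Fin n`, a parity and
-- a variable index. A sequence of independent vectors therefore suffices to label the edges.
theorem countable_unitEdges :
    {e : G × SuperDeg G × ℕ | UnitEdge B g e.1 (e.1 * varDeg e.2)}.Countable := by
  refine (Set.countable_range fun p : Fin n × Fin n × Multiplicative (ZMod 2) × ℕ =>
    ((g p.1, (((g p.1)⁻¹ * g p.2.1, p.2.2.1), p.2.2.2)) : G × SuperDeg G × ℕ)).mono ?_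
  rintro ⟨s, ⟨d, δ⟩, k⟩ ⟨i, j, rfl, hj, -⟩
  exact ⟨(i, j, δ, k), by simp [hj, varDeg]⟩

open scoped Classical in
/-- The weight which is `1` on the even edges of `B` and the vector with index `code e` on the
odd edges `e` of `B`. -/
def genericWeight (B : NonUnitalSubalgebra F (Matrix (Fin n) (Fin n) F)) (g : Fin n → G)
    (b : ℕ → V) (code : G × SuperDeg G × ℕ → ℕ) (e : G × SuperDeg G × ℕ) : ExteriorAlgebra F V :=
  if UnitEdge B g e.1 (e.1 * varDeg e.2) then
    if varParity e.2 = 1 then ExteriorAlgebra.ι F (b (code e)) else 1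
  else 0

variable {b : ℕ → V} {code : G × SuperDeg G × ℕ → ℕ}

theorem isAdmissibleWeight_genericWeight :
    IsAdmissibleWeight B g (genericWeight B g b code) := by
  classical
  refine ⟨fun e => ?_, fun e he => ?_⟩
  · unfold genericWeight
    split_ifs with h1 h2
    · rw [h2]; exact ι_mem_grassmannComponent _
    · rw [(zmod_two_eq_zero_or_one _).resolve_right h2]; exact one_mem_grassmannComponent
    · exact Submodule.zero_mem _
  · by_contra h
    exact he (if_neg h)

theorem IsAdmissibleWeight.smul {θ : G × SuperDeg G × ℕ → ExteriorAlgebra F V}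
    (hθ : IsAdmissibleWeight B g θ) (ξ : G × SuperDeg G × ℕ → F) :
    IsAdmissibleWeight B g fun e => ξ e • θ e :=
  ⟨fun e => Submodule.smul_mem _ _ (hθ.1 e), fun e he => hθ.2 e fun h => he (by simp [h])⟩

theorem walkWeight_smul {X K : Type*} [Ring K] [Algebra F K] (δ : X → G) (ξ : G × X → F)
    (θ : G × X → K) (s : G) (l : List X) :
    walkWeight δ (fun e => ξ e • θ e) s l =
      ((walkEdges δ s l).map ξ).prod • walkWeight δ θ s l := by
  induction l generalizing s with
  | nil => simp
  | cons v l ih =>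
    rw [walkWeight_cons, walkWeight_cons, ih, smul_mul_smul_comm, walkEdges_cons, List.map_cons,
      List.prod_cons]

/-- A walk in `B` along which the generic weight vanishes uses some odd labelled edge twice. -/
theorem exists_sublist_of_genericWeight_eq_zero (hb : LinearIndependent F b)
    (hcode : {e : G × SuperDeg G × ℕ | UnitEdge B g e.1 (e.1 * varDeg e.2)}.InjOn code) {s : G}
    {l : List (SuperDeg G × ℕ)} (hw : IsWalk (UnitEdge B g) s (l.map varDeg))
    (h0 : walkWeight varDeg (genericWeight B g b code) s l = 0) :
    ∃ e, varParity e.2 = 1 ∧ [e, e].Sublist (walkEdges varDeg s l) := by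
  classical
  rw [isWalk_map_iff] at hw
  -- Even edges contribute `1`, so the weight is the wedge of the vectors coded by the odd edges,
  -- nonzero when these edges are distinct.
  have key : ∀ L : List (G × SuperDeg G × ℕ), (∀ e ∈ L, UnitEdge B g e.1 (e.1 * varDeg e.2)) →
      (L.map (genericWeight B g b code)).prod =
        (((L.filter fun e => varParity e.2 = 1).map code).map
          fun i => ExteriorAlgebra.ι F (b i)).prod := by
    intro L hL
    induction L with
    | nil => simp
    | cons e L ih =>
      rw [List.forall_mem_cons] at hL
      rw [List.map_cons, List.prod_cons, ih hL.2, genericWeight, if_pos hL.1]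
      by_cases hp : varParity e.2 = 1 <;> simp [hp]
  rw [walkWeight, key _ hw] at h0
  have hnd : ¬ ((walkEdges varDeg s l).filter fun e => varParity e.2 = 1).Nodup := fun hnd =>
    prod_ι_ne_zero hb (hnd.map_on fun e he e' he' h =>
      hcode (hw e (List.mem_of_mem_filter he)) (hw e' (List.mem_of_mem_filter he')) h) h0
  rw [List.nodup_iff_sublist] at hnd
  push Not at hnd
  obtain ⟨e, he⟩ := hnd
  have h1 := List.mem_filter.1 (he.subset (List.mem_cons_self (l := [e])))
  exact ⟨e, by simpa using h1.2, he.trans List.filter_sublist⟩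

theorem listDeg_eq_of_walkEdges_perm {X : Type*} {δ : X → G} {l m : List X}
    (h : (walkEdges δ 1 l).Perm (walkEdges δ 1 m)) : listDeg δ l = listDeg δ m := by
  refine walkEdges_perm_induction δ (P := fun l m => listDeg δ l = listDeg δ m) (fun _ => rfl)
    Eq.trans (fun x l m h => by simp [h]) (fun {u t v} q huv _ => ?_) h
  simp [huv]

/-- The part of an identity which consists of the words with given labelled edges has generic
weight zero. -/
theorem sum_genericWeight_eq_zero [Infinite F] (hB : IsUnitSpanned B)
    (hg : Function.Injective g) {f : FreeGraded F (SuperDeg G)}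
    (hf : f ∈ gradedIdentities (A := B ⊗[F] ExteriorAlgebra F V)
      (tensorComponent (inducedComponent B g) (grassmannComponent F V)))
    (w₀ : FreeSemigroup (SuperDeg G × ℕ)) {i : Fin n}
    (hw : IsWalk (UnitEdge B g) (g i) ((letters w₀).map varDeg))
    [DecidablePred fun w : FreeSemigroup (SuperDeg G × ℕ) =>
      (walkEdges varDeg 1 (letters w)).Perm (walkEdges varDeg 1 (letters w₀))] :
    ∑ w ∈ f.coeff.support with
      (walkEdges varDeg 1 (letters w)).Perm (walkEdges varDeg 1 (letters w₀)),
      f.coeff w • walkWeight varDeg (genericWeight B g b code) (g i) (letters w) = 0 := by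
  classical
  obtain ⟨j, hj⟩ := exists_end_of_isWalk (letters_ne_nil w₀) hw
  rw [mem_gradedIdentities_iff hB hg] at hf
  -- Scaling edge `e` by `ξ e` makes the entry `(i, j)` a polynomial in `ξ`, whose monomials record
  -- the multisets of labelled edges.
  have h1 := sum_filter_eq_zero_of_forall_prod (F := F) f.coeff.support
    (fun w => ((walkEdges varDeg (g i) (letters w) : List _) : Multiset (G × SuperDeg G × ℕ)))
    (fun w => if g i * listDeg varDeg (letters w) = g j then
      f.coeff w • walkWeight varDeg (genericWeight B g b code) (g i) (letters w) else 0)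
    (fun ξ => by
      have hθ := (isAdmissibleWeight_genericWeight (B := B) (g := g) (b := b)
        (code := code)).smul ξ
      have h1 := hf _ hθ
      rw [eq_sum_listWord f, map_sum] at h1
      have h2 := congrFun (congrFun h1 i) j
      rw [Matrix.sum_apply] at h2
      refine Eq.trans (Finset.sum_congr rfl fun w _ => ?_) h2
      rw [map_smul, Matrix.smul_apply,
        evalAt_weightMatrix_listWord hg hθ (letters_ne_nil w), walkWeight_smul]
      split_ifs
      · rw [Multiset.map_coe, Multiset.prod_coe, smul_comm]
      · simp)
    (walkEdges varDeg (g i) (letters w₀) : List _)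
  refine Eq.trans ?_ h1
  have hiff : ∀ w : FreeSemigroup (SuperDeg G × ℕ),
      (walkEdges varDeg 1 (letters w)).Perm (walkEdges varDeg 1 (letters w₀)) ↔
      ((walkEdges varDeg (g i) (letters w) : List _) : Multiset (G × SuperDeg G × ℕ)) =
        (walkEdges varDeg (g i) (letters w₀) : List _) := fun w => by
    rw [Multiset.coe_eq_coe]
    exact walkEdges_perm_iff _ _ _ _ _
  simp only [← hiff]
  refine Finset.sum_congr rfl fun w hw' => ?_
  rw [if_pos]
  rw [listDeg_eq_of_walkEdges_perm (Finset.mem_filter.1 hw').2, hj]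

end Generic

/-! ### Completeness -/

section Completeness

variable {F V : Type*} [Field F] [CharZero F] [AddCommGroup V] [Module F V] {G : Type*} [Group G]
  {n : ℕ} {B : NonUnitalSubalgebra F (Matrix (Fin n) (Fin n) F)} {g : Fin n → G}
  {I : Submodule F (FreeGraded F (SuperDeg G))}

/-- If `w₀` reads no walk in `B`, neither does any word of its class, and each lies in `I`. If its
generic weight vanishes, each word repeats an odd edge. Otherwise the sum is congruent to `(∑ f_w
ε_w) w₀`, and the weights carry the same signs, so this coefficient is zero. -/
theorem sum_filter_mem (hV : ¬ FiniteDimensional F V) (hB : IsUnitSpanned B)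
    (hg : Function.Injective g) (hI : IsTIdeal I)
    (hS : ∀ f, SuperizedPolynomial F (gradingSupport B g) f → f ∈ I)
    (hM : superMonomials B g ⊆ I) {f : FreeGraded F (SuperDeg G)}
    (hf : f ∈ gradedIdentities (A := B ⊗[F] ExteriorAlgebra F V)
      (tensorComponent (inducedComponent B g) (grassmannComponent F V)))
    (w₀ : FreeSemigroup (SuperDeg G × ℕ))
    [DecidablePred fun w : FreeSemigroup (SuperDeg G × ℕ) =>
      (walkEdges varDeg 1 (letters w)).Perm (walkEdges varDeg 1 (letters w₀))] :
    ∑ w ∈ f.coeff.support with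
      (walkEdges varDeg 1 (letters w)).Perm (walkEdges varDeg 1 (letters w₀)),
      f.coeff w • listWord F (letters w) ∈ I := by
  have hwalk : ∀ w : FreeSemigroup (SuperDeg G × ℕ),
      (walkEdges varDeg 1 (letters w)).Perm (walkEdges varDeg 1 (letters w₀)) → ∀ i,
      (IsWalk (UnitEdge B g) (g i) ((letters w).map varDeg) ↔
        IsWalk (UnitEdge B g) (g i) ((letters w₀).map varDeg)) := fun w hw i => by
    rw [isWalk_map_iff, isWalk_map_iff]
    simp only [((walkEdges_perm_iff varDeg 1 (g i) _ _).1 hw).mem_iff]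
  by_cases hi : ∃ i, IsWalk (UnitEdge B g) (g i) ((letters w₀).map varDeg)
  swap
  · push Not at hi
    refine Submodule.sum_mem _ fun w hw => Submodule.smul_mem _ _ ?_
    refine listWord_mem_of_not_isWalk hB hg hI hS hM (letters_ne_nil w) fun i => ?_
    rw [hwalk w (Finset.mem_filter.1 hw).2]
    exact hi i
  obtain ⟨i, hi⟩ := hi
  obtain ⟨b, hb⟩ := exists_linearIndependent_nat hV
  obtain ⟨code, hcode⟩ := Set.countable_iff_exists_injOn.1 (countable_unitEdges B g)
  have hsum := sum_genericWeight_eq_zero (b := b) (code := code) hB hg hf w₀ hi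
  have hsign := fun (w : FreeSemigroup (SuperDeg G × ℕ))
    (hw : (walkEdges varDeg 1 (letters w)).Perm (walkEdges varDeg 1 (letters w₀))) =>
    exists_sign_of_walkEdges_perm (V := V) hI hS hw
  choose! ε hε hεθ using hsign
  have hθ := (isAdmissibleWeight_genericWeight (B := B) (g := g) (b := b) (code := code)).1
  by_cases h0 : walkWeight varDeg (genericWeight B g b code) (g i) (letters w₀) = 0
  · refine Submodule.sum_mem _ fun w hw => Submodule.smul_mem _ _ ?_
    have hw' := (Finset.mem_filter.1 hw).2
    obtain ⟨e, he, hsub⟩ := exists_sublist_of_genericWeight_eq_zero hb hcode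
      ((hwalk w hw' i).2 hi) (by rw [hεθ w hw' _ hθ, h0, smul_zero])
    exact listWord_mem_of_repeated_odd hI hS he hsub
  · have h1 : ∑ w ∈ f.coeff.support with
        (walkEdges varDeg 1 (letters w)).Perm (walkEdges varDeg 1 (letters w₀)),
        f.coeff w * ε w = 0 := by
      refine (smul_eq_zero.1 ?_).resolve_right h0
      rw [Finset.sum_smul, ← hsum]
      refine Finset.sum_congr rfl fun w hw => ?_
      rw [hεθ w (Finset.mem_filter.1 hw).2 _ hθ, smul_smul]
    have h2 : ∑ w ∈ f.coeff.support with
        (walkEdges varDeg 1 (letters w)).Perm (walkEdges varDeg 1 (letters w₀)),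
        f.coeff w • listWord F (letters w) =
        ∑ w ∈ f.coeff.support with
          (walkEdges varDeg 1 (letters w)).Perm (walkEdges varDeg 1 (letters w₀)),
          f.coeff w • (listWord F (letters w) - ε w • listWord F (letters w₀)) := by
      simp only [smul_sub, smul_smul, Finset.sum_sub_distrib]
      rw [← Finset.sum_smul, h1, zero_smul, sub_zero]
    rw [h2]
    exact Submodule.sum_mem _ fun w hw =>
      Submodule.smul_mem _ _ (hε w (Finset.mem_filter.1 hw).2)

theorem gradedIdentities_le (hV : ¬ FiniteDimensional F V) (hB : IsUnitSpanned B)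
    (hg : Function.Injective g) (hI : IsTIdeal I)
    (hS : ∀ f, SuperizedPolynomial F (gradingSupport B g) f → f ∈ I)
    (hM : superMonomials B g ⊆ I) :
    gradedIdentities (A := B ⊗[F] ExteriorAlgebra F V)
      (tensorComponent (inducedComponent B g) (grassmannComponent F V)) ≤ I := by
  classical
  intro f hf
  let M : FreeSemigroup (SuperDeg G × ℕ) → Multiset (G × SuperDeg G × ℕ) := fun w =>
    (walkEdges varDeg 1 (letters w) : List _)
  rw [eq_sum_listWord f, ← Finset.sum_fiberwise_of_maps_to
    (fun w hw => Finset.mem_image_of_mem M hw)]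
  refine Submodule.sum_mem _ fun μ hμ => ?_
  obtain ⟨w₀, -, rfl⟩ := Finset.mem_image.1 hμ
  simpa only [M, Multiset.coe_eq_coe] using sum_filter_mem hV hB hg hI hS hM hf w₀

end Completeness

end GradedPI

end

theorem mainTheorem6 {F : Type*} [Field F] [CharZero F] {V : Type*} [AddCommGroup V] [Module F V]
    (hV : ¬ FiniteDimensional F V) {G : Type*} [Group G] (n : ℕ) (g : Fin n → G)
    (hg : Function.Injective g) (S : Set (Fin n × Fin n))
    (B : NonUnitalSubalgebra F (Matrix (Fin n) (Fin n) F))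
    (hB : B = GradedPI.matrixUnitAlgebra F S) :
    (GradedPI.superMonomials B g).Finite ∧
    GradedPI.IsIdentityBasis (A := B ⊗[F] ExteriorAlgebra F V)
      ({f | GradedPI.SuperizedPolynomial F (GradedPI.gradingSupport B g) f} ∪
        GradedPI.superMonomials B g)
      (GradedPI.tensorComponent (GradedPI.inducedComponent B g)
        (GradedPI.grassmannComponent F V)) := by
  have hBS : GradedPI.IsUnitSpanned B := hB ▸ GradedPI.isUnitSpanned_matrixUnitAlgebra S
  refine ⟨GradedPI.finite_superMonomials hBS, le_antisymm ?_ ?_⟩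
  · refine GradedPI.tIdealSpan_le (GradedPI.isTIdeal_gradedIdentities fun h k x hx y hy =>
      GradedPI.tensorComponent_mul_mem hBS hx hy) ?_
    rintro f (hf | hf)
    · exact GradedPI.superizedPolynomial_mem_gradedIdentities hBS hg hf
    · exact GradedPI.superMonomials_subset_gradedIdentities hBS hg hf
  · exact GradedPI.gradedIdentities_le hV hBS hg (GradedPI.isTIdeal_tIdealSpan _)
      (fun f hf => GradedPI.subset_tIdealSpan _ (Or.inl hf))
      (fun f hf => GradedPI.subset_tIdealSpan _ (Or.inr hf))
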